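/- Let $\mathrm{Diff}(\mathbb{C},0)$ be the group, under composition, of germs of analytic diffeomorphisms of $\mathbb{C}$ fixing $0$, let $r>0$, and let $\Delta$ be the disc of radius $r$ around $0$. Write $\mathrm{Aut}(\Delta)$ for the set of germs, at points of $\Delta$, of invertible holomorphic maps with values in $\Delta$. The D-groupoids on $\Delta$ are given by one of the following equations for $y=y(x)$, where $y_i=d^iy/dx^i$: - $G_0(h)$: $h(x)-h(y)=0$, with $h$ holomorphic on $\Delta$; - $G_1^n(\eta)$: $\eta(y)\,y_1^n-\eta(x)=0$, with $n\in\mathbb{Z}$ and $\eta$ meromorphic on $\Delta$; - $G_2(\mu)$: $\mu(y)\,y_1+\frac{y_2}{y_1}-\mu(x)=0$, with $\mu$ meromorphic on $\Delta$; - $G_3(\nu)$: $\nu(y)\,y_1^2+2\frac{y_3}{y_1}-3\left(\frac{y_2}{y_1}\right)^2-\nu(x)=0$, with $\nu$ meromorphic on $\Delta$; - $G_\infty$: $0=0$. The solutions of a D-groupoid are the germs in $\mathrm{Aut}(\Delta)$ that satisfy its equation on a punctured neighbourhood of their base point. The Galois closure of a subgroup $G$ of $\mathrm{Diff}(\mathbb{C},0)$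 is the smallest D-groupoid in this list that has all elements of $G$ among its solutions; its solutions are the common solutions of all the D-groupoids in the list that have all elements of $G$ among their solutions. It is proper if its set of solutions is not the whole of $\mathrm{Aut}(\Delta)$. **Proposition 1.7.** Let $G$ be a subgroup of $\mathrm{Diff}(\mathbb{C},0)$ that has a proper Galois closure on $\Delta$. Then $G$ is solvable. Moreover, the subgroup $G_1=\{g\in G: g'(0)=1\}$ is abelian, and there is a formal vector field $\theta=a(z)\frac{d}{dz}$ with $a\in z^2\mathbb{C}[[z]]$ such that for every $g\in G_1$ there is $c\in\mathbb{C}$ for which the Taylor series of $g$ at $0$ is $\exp(c\,\theta)(z)=\sum_{n\ge 0}\frac{c^n}{n!}\theta^n(z)$. -/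

import Mathlib

open Filter Topology

noncomputable section

namespace GaloisClosure

/-! ### The group `Diff(ℂ, 0)` of germs of analytic diffeomorphisms fixing the origin -/

/-- Germs at `0` of analytic maps `f : (ℂ, 0) → (ℂ, 0)`, possibly not invertible. -/
def MapGerm : Type :=
  {φ : (𝓝 (0 : ℂ)).Germ ℂ // ∃ f : ℂ → ℂ, AnalyticAt ℂ f 0 ∧ f 0 = 0 ∧ φ = (f : (𝓝 (0 : ℂ)).Germ ℂ)}

/-- The germ at `0` of an analytic function fixing `0`. -/
def MapGerm.of (f : ℂ → ℂ) (hf : AnalyticAt ℂ f 0) (h0 : f 0 = 0) : MapGerm :=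
  ⟨(f : (𝓝 (0 : ℂ)).Germ ℂ), f, hf, h0, rfl⟩

/-- A function representing a germ. Everything below depends only on the germ. -/
def MapGerm.rep (φ : MapGerm) : ℂ → ℂ := φ.2.choose

theorem MapGerm.rep_analyticAt (φ : MapGerm) : AnalyticAt ℂ φ.rep 0 := φ.2.choose_spec.1

theorem MapGerm.rep_zero (φ : MapGerm) : φ.rep 0 = 0 := φ.2.choose_spec.2.1

theorem MapGerm.coe_rep (φ : MapGerm) : (φ.rep : (𝓝 (0 : ℂ)).Germ ℂ) = φ.1 :=
  φ.2.choose_spec.2.2.symm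

theorem MapGerm.rep_tendsto (φ : MapGerm) : Tendsto φ.rep (𝓝 0) (𝓝 0) := by
  have h := φ.rep_analyticAt.continuousAt.tendsto
  rwa [φ.rep_zero] at h

theorem MapGerm.ext_rep {φ ψ : MapGerm} (h : φ.rep =ᶠ[𝓝 0] ψ.rep) : φ = ψ := by
  apply Subtype.ext
  rw [← φ.coe_rep, ← ψ.coe_rep]
  exact Germ.coe_eq.2 h

theorem MapGerm.rep_of (f : ℂ → ℂ) (hf : AnalyticAt ℂ f 0) (h0 : f 0 = 0) :
    (MapGerm.of f hf h0).rep =ᶠ[𝓝 0] f :=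
  Germ.coe_eq.1 (MapGerm.of f hf h0).coe_rep

/-- Composition of germs. -/
instance : Mul MapGerm where
  mul φ ψ := MapGerm.of (φ.rep ∘ ψ.rep)
    (AnalyticAt.comp (by rw [ψ.rep_zero]; exact φ.rep_analyticAt) ψ.rep_analyticAt)
    (by simp [ψ.rep_zero, φ.rep_zero])

/-- The germ of the identity. -/
instance : One MapGerm where
  one := MapGerm.of id analyticAt_id rfl

theorem MapGerm.rep_mul (φ ψ : MapGerm) : (φ * ψ).rep =ᶠ[𝓝 0] φ.rep ∘ ψ.rep :=
  MapGerm.rep_of _ _ _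

theorem MapGerm.rep_one : (1 : MapGerm).rep =ᶠ[𝓝 0] id :=
  MapGerm.rep_of _ _ _

instance : Monoid MapGerm where
  mul_assoc a b c := by
    apply MapGerm.ext_rep
    have h1 : (a * b).rep ∘ c.rep =ᶠ[𝓝 0] (a.rep ∘ b.rep) ∘ c.rep :=
      (MapGerm.rep_mul a b).comp_tendsto c.rep_tendsto
    have h2 : a.rep ∘ (b * c).rep =ᶠ[𝓝 0] a.rep ∘ (b.rep ∘ c.rep) :=
      (MapGerm.rep_mul b c).fun_comp a.rep
    exact ((MapGerm.rep_mul (a * b) c).trans h1).trans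
      ((MapGerm.rep_mul a (b * c)).trans h2).symm
  one_mul a := by
    apply MapGerm.ext_rep
    exact (MapGerm.rep_mul 1 a).trans (MapGerm.rep_one.comp_tendsto a.rep_tendsto)
  mul_one a := by
    apply MapGerm.ext_rep
    exact (MapGerm.rep_mul a 1).trans (MapGerm.rep_one.fun_comp a.rep)

/-- `Diff(ℂ, 0)`: the group, under composition, of the germs of analytic maps
`(ℂ, 0) → (ℂ, 0)` that have an analytic inverse germ. -/
abbrev Diff : Type := MapGermˣ

/-- A function representing the germ `g`. -/
def Diff.rep (g : Diff) : ℂ → ℂ := (g : MapGerm).rep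

theorem Diff.deriv_rep_mul (g h : Diff) :
    deriv (Diff.rep (g * h)) 0 = deriv (Diff.rep g) 0 * deriv (Diff.rep h) 0 := by
  have e : Diff.rep (g * h) =ᶠ[𝓝 0] Diff.rep g ∘ Diff.rep h :=
    MapGerm.rep_mul (g : MapGerm) (h : MapGerm)
  have h0 : Diff.rep h 0 = 0 := MapGerm.rep_zero _
  have hg : DifferentiableAt ℂ (Diff.rep g) (Diff.rep h 0) := by
    rw [h0]; exact (MapGerm.rep_analyticAt _).differentiableAt
  rw [e.deriv_eq, deriv_comp 0 hg (MapGerm.rep_analyticAt _).differentiableAt, h0]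

theorem Diff.deriv_rep_one : deriv (Diff.rep 1) 0 = 1 := by
  have e : Diff.rep 1 =ᶠ[𝓝 0] id := MapGerm.rep_one
  rw [e.deriv_eq]
  simp

/-- The subgroup of `Diff(ℂ, 0)` of the germs tangent to the identity: `g'(0) = 1`. -/
def tangentToId : Subgroup Diff where
  carrier := {g | deriv g.rep 0 = 1}
  mul_mem' {g h} hg hh := by
    change deriv (Diff.rep (g * h)) 0 = 1
    rw [Diff.deriv_rep_mul, show deriv (Diff.rep g) 0 = 1 from hg,
      show deriv (Diff.rep h) 0 = 1 from hh, one_mul]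
  one_mem' := Diff.deriv_rep_one
  inv_mem' {g} hg := by
    change deriv (Diff.rep g⁻¹) 0 = 1
    have h := Diff.deriv_rep_mul g g⁻¹
    rw [mul_inv_cancel, Diff.deriv_rep_one, show deriv (Diff.rep g) 0 = 1 from hg, one_mul] at h
    exact h.symm

/-! ### The D-groupoids on a disc -/

/-- `Aut(Δ)` for the disc `Δ` of radius `r` around `0`: the germs of invertible holomorphic maps
from `Δ` to itself. The pair `(a, f)` stands for the germ at the point `a` of the function `f`. -/
def autDisc (r : ℝ) : Set (ℂ × (ℂ → ℂ)) :=
  {p | p.1 ∈ Metric.ball (0 : ℂ) r ∧ AnalyticAt ℂ p.2 p.1 ∧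
    p.2 p.1 ∈ Metric.ball (0 : ℂ) r ∧ deriv p.2 p.1 ≠ 0}

/-- The list of the D-groupoids on the disc `Δ` of radius `r` around `0`. -/
inductive DGroupoid (r : ℝ) : Type
  /-- `G₀(h)`, `h` holomorphic on `Δ`. -/
  | order0 (h : ℂ → ℂ) (hh : DifferentiableOn ℂ h (Metric.ball 0 r))
  /-- `G₁ⁿ(η)`, `n` an integer, `η` meromorphic on `Δ`. -/
  | order1 (n : ℤ) (η : ℂ → ℂ) (hη : MeromorphicOn η (Metric.ball 0 r))
  /-- `G₂(μ)`, `μ` meromorphic on `Δ`. -/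
  | order2 (μ : ℂ → ℂ) (hμ : MeromorphicOn μ (Metric.ball 0 r))
  /-- `G₃(ν)`, `ν` meromorphic on `Δ`. -/
  | order3 (ν : ℂ → ℂ) (hν : MeromorphicOn ν (Metric.ball 0 r))
  /-- `G_∞`. -/
  | infinite

/-- The differential equation of a D-groupoid, for `y = f(x)`, at the point `x`. -/
def DGroupoid.Equation {r : ℝ} (D : DGroupoid r) (f : ℂ → ℂ) (x : ℂ) : Prop :=
  match D with
  | .order0 h _ => h x - h (f x) = 0
  | .order1 n η _ => η (f x) * deriv f x ^ n - η x = 0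
  | .order2 μ _ => μ (f x) * deriv f x + iteratedDeriv 2 f x / deriv f x - μ x = 0
  | .order3 ν _ =>
      ν (f x) * deriv f x ^ 2 + 2 * (iteratedDeriv 3 f x / deriv f x)
        - 3 * (iteratedDeriv 2 f x / deriv f x) ^ 2 - ν x = 0
  | .infinite => (0 : ℂ) = 0

/-- The solutions of a D-groupoid: the germs in `Aut(Δ)` that satisfy its equation. As the
coefficients may have a pole at the base point or at its image, the equation is required on a
punctured neighbourhood of the base point. -/
def DGroupoid.sol {r : ℝ} (D : DGroupoid r) : Set (ℂ × (ℂ → ℂ)) :=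
  {p | p ∈ autDisc r ∧ ∀ᶠ x in 𝓝[≠] p.1, D.Equation p.2 x}

/-- All the elements of `G` are solutions of `D`. -/
def DGroupoid.Admits {r : ℝ} (D : DGroupoid r) (G : Subgroup Diff) : Prop :=
  ∀ g ∈ G, ((0 : ℂ), g.rep) ∈ D.sol

/-- The Galois closure `Gal(G)` on the disc of radius `r`, given by its solutions: the common
solutions of all the D-groupoids that admit every element of `G`. These are the solutions of the
smallest such D-groupoid (`galoisClosure_eq_sol`). -/
def galoisClosure (r : ℝ) (G : Subgroup Diff) : Set (ℂ × (ℂ → ℂ)) :=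
  {p | ∀ D : DGroupoid r, D.Admits G → p ∈ D.sol}

/-- If `D` is the smallest D-groupoid that admits `G`, then `Gal(G)` is `D`. -/
theorem galoisClosure_eq_sol {r : ℝ} {G : Subgroup Diff} (D : DGroupoid r) (hD : D.Admits G)
    (hmin : ∀ D' : DGroupoid r, D'.Admits G → D.sol ⊆ D'.sol) : galoisClosure r G = D.sol :=
  Set.Subset.antisymm (fun _ hp => hp D hD) (fun _ hp D' hD' => hmin D' hD' hp)

/-- The Galois closure of `G` is proper: it is not the whole of `Aut(Δ)`. -/
def HasProperGaloisClosure (r : ℝ) (G : Subgroup Diff) : Prop :=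
  galoisClosure r G ≠ autDisc r

/-! ### Formal vector fields and their exponentials -/

/-- The Taylor series at `0` of a germ. -/
def Diff.taylor (g : Diff) : PowerSeries ℂ :=
  PowerSeries.mk fun k => iteratedDeriv k g.rep 0 / (k.factorial : ℂ)

/-- The action `φ ↦ a · dφ/dz` of the formal vector field `θ = a(z) d/dz` on formal series. -/
def vectorField (a : PowerSeries ℂ) (φ : PowerSeries ℂ) : PowerSeries ℂ :=
  a * PowerSeries.derivative ℂ φ

/-- `φ` is `exp(c θ)` for the formal vector field `θ = a(z) d/dz`: it is the sum, coefficient by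
coefficient, of the exponential series `∑ₙ (cⁿ / n!) θⁿ(z)`. -/
def IsExp (c : ℂ) (a : PowerSeries ℂ) (φ : PowerSeries ℂ) : Prop :=
  ∀ k : ℕ, HasSum
    (fun n : ℕ => c ^ n / (n.factorial : ℂ) *
      PowerSeries.coeff k ((vectorField a)^[n] PowerSeries.X))
    (PowerSeries.coeff k φ)

end GaloisClosure

end

/- The germs `g ≠ id` of `G` tangent to the identity are of the form `z + β z ^ (j + 1) + ⋯` with
`β ≠ 0`. Comparing leading terms in the equation of a proper D-groupoid shows that its coefficient
determines `j`. With `j` the same for all of them, `β` is additive under composition, so commutators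
of such germs are trivial; the multiplier `g ↦ g'(0)` then makes `G` solvable. Finally, a formal
series tangent to the identity and commuting with such a germ `g` is determined by its coefficient
of degree `j + 1`, so it belongs to the formal flow through `g`. -/

noncomputable section

namespace GaloisClosure

section AlgHom

open PowerSeries

variable {R : Type*} [CommRing R]

theorem eq_zero_of_forall_X_pow_dvd {φ : R⟦X⟧} (h : ∀ n, X ^ n ∣ φ) : φ = 0 := by
  ext k
  simpa using X_pow_dvd_iff.1 (h (k + 1)) k k.lt_succ_self

theorem X_pow_succ_dvd_sub {φ : R⟦X⟧} {m : ℕ} (h : X ^ m ∣ φ) :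
    X ^ (m + 1) ∣ φ - C (coeff m φ) * X ^ m := by
  rw [X_pow_dvd_iff] at h ⊢
  intro i hi
  rw [map_sub, coeff_C_mul, coeff_X_pow]
  rcases (Nat.lt_succ_iff.1 hi).lt_or_eq with hlt | rfl
  · simp [h i hlt, hlt.ne]
  · simp

theorem exists_coeff_ne_zero {φ : R⟦X⟧} {m : ℕ} (h : X ^ m ∣ φ) (h0 : φ ≠ 0) :
    ∃ n, m ≤ n ∧ X ^ n ∣ φ ∧ coeff n φ ≠ 0 :=
  ⟨φ.order.toNat, not_lt.1 fun hlt => coeff_order h0 (X_pow_dvd_iff.1 h _ hlt),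
    X_pow_order_dvd, coeff_order h0⟩

theorem coeff_succ_sub_X {φ : R⟦X⟧} {j : ℕ} (hj : 1 ≤ j) :
    coeff (j + 1) (φ - X) = coeff (j + 1) φ := by
  rw [map_sub, coeff_X, if_neg (by lia), sub_zero]

variable {ρ σ τ : R⟦X⟧ →ₐ[R] R⟦X⟧} {i j m : ℕ} {φ : R⟦X⟧}

theorem X_pow_dvd_algHom (hσ : X ∣ σ X) (hφ : X ^ i ∣ φ) : X ^ i ∣ σ φ := by
  obtain ⟨ψ, rfl⟩ := hφ
  rw [map_mul, map_pow]
  exact (pow_dvd_pow_of_dvd hσ i).mul_right _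

theorem coeff_algHom (hσ : X ∣ σ X) (φ : R⟦X⟧) (k : ℕ) :
    coeff k (σ φ) = ∑ i ∈ Finset.range (k + 1), coeff i φ * coeff k (σ X ^ i) := by
  have hφ : X ^ (k + 1) ∣ φ - ∑ i ∈ Finset.range (k + 1), coeff i φ • X ^ i := by
    rw [X_pow_dvd_iff]
    intro l hl
    simp [coeff_X_pow, Nat.lt_succ_iff.1 hl]
  have h := X_pow_dvd_iff.1 (X_pow_dvd_algHom hσ hφ) k k.lt_succ_self
  rw [map_sub, map_sub, sub_eq_zero] at h
  simp [h]

theorem algHom_ext_X (hτ : X ∣ τ X) (h : σ X = τ X) : σ = τ := by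
  ext φ k
  rw [coeff_algHom (h ▸ hτ), coeff_algHom hτ, h]

theorem X_dvd_of_X_sq_dvd_sub_X {φ : R⟦X⟧} (h : X ^ 2 ∣ φ - X) : X ∣ φ := by
  rw [← sub_add_cancel φ X]
  exact ((dvd_pow_self X two_ne_zero).trans h).add dvd_rfl

theorem X_pow_dvd_algHom_sub (hσ : X ∣ σ X) (hτ : X ∣ τ X) (h : X ^ m ∣ σ X - τ X) (φ : R⟦X⟧) :
    X ^ m ∣ σ φ - τ φ := by
  rw [X_pow_dvd_iff]
  intro k hk
  rw [map_sub, coeff_algHom hσ, coeff_algHom hτ, ← Finset.sum_sub_distrib]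
  refine Finset.sum_eq_zero fun i _ => ?_
  rw [← mul_sub, ← map_sub, X_pow_dvd_iff.1 (h.trans (sub_dvd_pow_sub_pow _ _ i)) k hk, mul_zero]

theorem X_pow_add_dvd_algHom_sub (hσ : X ∣ σ X) (hτ : X ∣ τ X) (h : X ^ (j + 1) ∣ σ X - τ X)
    (hφ : X ^ i ∣ φ) : X ^ (i + j) ∣ σ φ - τ φ := by
  induction i generalizing φ with
  | zero => exact (pow_dvd_pow X (by lia)).trans (X_pow_dvd_algHom_sub hσ hτ h φ)
  | succ i ih =>
    obtain ⟨χ, rfl⟩ := hφ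
    obtain ⟨ψ, hψ, hX⟩ : ∃ ψ : R⟦X⟧, X ^ i ∣ ψ ∧ X ^ (i + 1) * χ = X * ψ :=
      ⟨X ^ i * χ, dvd_mul_right _ _, by ring⟩
    have hsplit : σ (X * ψ) - τ (X * ψ) = (σ X - τ X) * σ ψ + τ X * (σ ψ - τ ψ) := by
      rw [map_mul, map_mul]; ring
    rw [hX, hsplit]
    refine dvd_add ?_ ?_
    · exact (pow_dvd_pow X (by lia)).trans
        ((pow_add X _ _).dvd.trans (mul_dvd_mul h (X_pow_dvd_algHom hσ hψ)))
    · rw [show i + 1 + j = 1 + (i + j) by lia, pow_add, pow_one]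
      exact mul_dvd_mul hτ (ih hψ)

/-- The two endomorphisms differ to first order by the derivation `b X ^ (j + 1) d/dX`, which
multiplies the leading term of a series of order `i` by `i b X ^ j`. -/
theorem X_pow_dvd_algHom_sub_sub (hσ : X ^ 2 ∣ σ X - X) (hτ : X ^ 2 ∣ τ X - X)
    (h : X ^ (j + 1) ∣ σ X - τ X) (hφ : X ^ i ∣ φ) :
    X ^ (i + j + 1) ∣ σ φ - τ φ - C (i * coeff (j + 1) (σ X - τ X)) * X ^ j * φ := by
  have hσX := X_dvd_of_X_sq_dvd_sub_X hσ
  have hτX := X_dvd_of_X_sq_dvd_sub_X hτ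
  set b := coeff (j + 1) (σ X - τ X)
  induction i generalizing φ with
  | zero => simpa using X_pow_dvd_algHom_sub hσX hτX h φ
  | succ i ih =>
    obtain ⟨χ, rfl⟩ := hφ
    obtain ⟨ψ, hψ, hX⟩ : ∃ ψ : R⟦X⟧, X ^ i ∣ ψ ∧ X ^ (i + 1) * χ = X * ψ :=
      ⟨X ^ i * χ, dvd_mul_right _ _, by ring⟩
    have hsplit : σ (X * ψ) - τ (X * ψ) - C ((i + 1 : ℕ) * b) * X ^ j * (X * ψ) =
        (σ X - τ X - C b * X ^ (j + 1)) * σ ψ + C b * (X ^ (j + 1) * (σ ψ - ψ)) +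
          (τ X - X) * (σ ψ - τ ψ) + X * (σ ψ - τ ψ - C (i * b) * X ^ j * ψ) := by
      simp only [map_mul, map_natCast]; push_cast; ring
    have hmul : ∀ {k l : ℕ} {α β : R⟦X⟧}, i + 1 + j + 1 ≤ k + l → X ^ k ∣ α → X ^ l ∣ β →
        X ^ (i + 1 + j + 1) ∣ α * β := fun hkl hα hβ =>
      (pow_dvd_pow X hkl).trans ((pow_add X _ _).dvd.trans (mul_dvd_mul hα hβ))
    have hσψ : X ^ (i + 1) ∣ σ ψ - ψ :=
      X_pow_add_dvd_algHom_sub (τ := AlgHom.id R _) hσX dvd_rfl hσ hψ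
    rw [hX, hsplit]
    refine (((hmul ?_ (X_pow_succ_dvd_sub h) (X_pow_dvd_algHom hσX hψ)).add
      ((hmul ?_ dvd_rfl hσψ).mul_left _)).add
      (hmul ?_ hτ (X_pow_add_dvd_algHom_sub hσX hτX h hψ))).add
      (hmul ?_ (pow_one X).dvd (ih hψ)) <;> lia

theorem coeff_algHom_sub (hσ : X ^ 2 ∣ σ X - X) (hτ : X ^ 2 ∣ τ X - X)
    (h : X ^ (j + 1) ∣ σ X - τ X) (hφ : X ^ i ∣ φ) :
    coeff (i + j) (σ φ - τ φ) = i * coeff (j + 1) (σ X - τ X) * coeff i φ := by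
  have hcoeff := X_pow_dvd_iff.1 (X_pow_dvd_algHom_sub_sub hσ hτ h hφ) (i + j) (by lia)
  rw [map_sub, sub_eq_zero] at hcoeff
  rw [hcoeff, mul_assoc, coeff_C_mul, coeff_X_pow_mul]

theorem coeff_algHom_of_X_sq_dvd_sub (hj : 1 ≤ j) (hσ : X ^ (j + 1) ∣ σ X - X)
    (hφ : X ^ 2 ∣ φ - X) : coeff (j + 1) (σ φ) = coeff (j + 1) (σ X) + coeff (j + 1) φ := by
  have h1 : coeff 1 φ = 1 := by
    have := X_pow_dvd_iff.1 hφ 1 (by lia)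
    rwa [map_sub, coeff_one_X, sub_eq_zero] at this
  have h := coeff_algHom_sub (τ := AlgHom.id R _) (i := 1) (φ := φ)
    ((pow_dvd_pow X (by lia)).trans hσ) (by simp) hσ (by simpa using X_dvd_of_X_sq_dvd_sub_X hφ)
  rw [AlgHom.id_apply, AlgHom.id_apply, coeff_succ_sub_X hj, h1, Nat.cast_one, one_mul, mul_one,
    map_sub, sub_eq_iff_eq_add, add_comm 1 j] at h
  exact h

/-- If `σ` and `τ` first differ in degree `m + 1`, comparing the coefficients of degree `m + j + 1`
in `ρ ((σ - τ) X) = (σ - τ) (ρ X)` gives `m = j`. -/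
theorem algHom_eq_of_commute [IsDomain R] [CharZero R] (hj : 1 ≤ j) (hρ : X ^ (j + 1) ∣ ρ X - X)
    (hρ0 : coeff (j + 1) (ρ X) ≠ 0) (hσ : X ^ 2 ∣ σ X - X) (hτ : X ^ 2 ∣ τ X - X)
    (hρσ : Commute ρ σ) (hρτ : Commute ρ τ) (h : X ^ (j + 2) ∣ σ X - τ X) : σ = τ := by
  by_contra hne
  have hδ : σ X - τ X ≠ 0 := fun h0 =>
    hne (algHom_ext_X (X_dvd_of_X_sq_dvd_sub_X hτ) (sub_eq_zero.1 h0))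
  obtain ⟨n, hjn, hdvd, hn⟩ := exists_coeff_ne_zero h hδ
  obtain ⟨m, rfl⟩ : ∃ m, n = m + 1 := ⟨n - 1, by lia⟩
  have hρ2 : X ^ 2 ∣ ρ X - X := (pow_dvd_pow X (by lia)).trans hρ
  have hleft := coeff_algHom_sub (τ := AlgHom.id R _) hρ2 (by simp) hρ hdvd
  have hright := coeff_algHom_sub hσ hτ hdvd hρ
  have hcomm : ρ (σ X - τ X) - (σ X - τ X) = σ (ρ X - X) - τ (ρ X - X) := by
    have h1 : ρ (σ X) = σ (ρ X) := DFunLike.congr_fun hρσ.eq X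
    have h2 : ρ (τ X) = τ (ρ X) := DFunLike.congr_fun hρτ.eq X
    simp only [map_sub, h1, h2]; ring
  rw [AlgHom.id_apply, AlgHom.id_apply, hcomm, show m + 1 + j = j + 1 + m by lia, hright,
    coeff_succ_sub_X hj, mul_assoc, mul_assoc, mul_comm (coeff (m + 1) _)] at hleft
  have := mul_right_cancel₀ (mul_ne_zero hρ0 hn) hleft
  norm_cast at this
  lia

theorem X_pow_dvd_pow_apply_X_sub (hρ : X ^ (j + 1) ∣ ρ X - X) (hj : 1 ≤ j) (n : ℕ) :
    X ^ (j + 1) ∣ (ρ ^ n) X - X := by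
  have hX := X_dvd_of_X_sq_dvd_sub_X ((pow_dvd_pow X (by lia)).trans hρ)
  induction n with
  | zero => simp
  | succ n ih =>
    have hsplit : (ρ ^ (n + 1)) X - X = ρ ((ρ ^ n) X - X) + (ρ X - X) := by
      rw [_root_.pow_succ', AlgHom.mul_apply, map_sub, sub_add_sub_cancel]
    rw [hsplit]
    exact (X_pow_dvd_algHom hX ih).add hρ

theorem coeff_pow_apply_X (hρ : X ^ (j + 1) ∣ ρ X - X) (hj : 1 ≤ j) (n : ℕ) :
    coeff (j + 1) ((ρ ^ n) X) = n * coeff (j + 1) (ρ X) := by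
  induction n with
  | zero => simp [coeff_X, show j ≠ 0 by lia]
  | succ n ih =>
    rw [_root_.pow_succ', AlgHom.mul_apply, coeff_algHom_of_X_sq_dvd_sub hj hρ
      ((pow_dvd_pow X (by lia)).trans (X_pow_dvd_pow_apply_X_sub hρ hj n)), ih]
    push_cast; ring

theorem X_pow_dvd_sub_one_pow_apply (hρ : X ^ 2 ∣ ρ X - X) (φ : R⟦X⟧) (n : ℕ) :
    X ^ n ∣ ((ρ.toLinearMap - 1) ^ n) φ := by
  induction n with
  | zero => simp
  | succ n ih =>
    rw [_root_.pow_succ' (ρ.toLinearMap - 1)]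
    exact X_pow_add_dvd_algHom_sub (τ := AlgHom.id R _) (j := 1)
      (X_dvd_of_X_sq_dvd_sub_X hρ) dvd_rfl hρ ih

theorem derivation_eq_mul_derivative (D : Derivation R R⟦X⟧ R⟦X⟧)
    (φ : R⟦X⟧) : D φ = D X * PowerSeries.derivative R φ := by
  set D' := D - D X • PowerSeries.derivative R
  have hX : D' X = 0 := by simp [D']
  have hdvd : ∀ (n : ℕ) (φ : R⟦X⟧), X ^ n ∣ D' φ := by
    intro n
    induction n with
    | zero => simp
    | succ n ih =>
      intro φ
      rw [φ.eq_X_mul_shift_add_const, map_add, D'.leibniz, hX, smul_zero, add_zero, smul_eq_mul,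
        C_eq_algebraMap, D'.map_algebraMap, add_zero, _root_.pow_succ']
      exact mul_dvd_mul_left X (ih _)
  exact sub_eq_zero.1 (eq_zero_of_forall_X_pow_dvd fun n => hdvd n φ)

end AlgHom

section Flow

open PowerSeries

theorem polynomial_ext_natCast {R : Type*} [CommRing R] [IsDomain R] [CharZero R]
    {p q : Polynomial R}
    (h : ∀ n : ℕ, p.eval (n : R) = q.eval (n : R)) : p = q :=
  p.eq_of_infinite_eval_eq q (Set.infinite_of_injective_forall_mem Nat.cast_injective h)

variable {K : Type*} [Field K] {ρ σ : K⟦X⟧ →ₐ[K] K⟦X⟧} {j k : ℕ}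

variable (ρ) in
/-- The `k`-th coefficient of the iterates `ρⁿ φ`, as a polynomial in `n`: this is the Newton series
`∑ i ≤ k, (n choose i) (ρ - 1)ⁱ φ`, cut off where it stops contributing to that coefficient when
`ρ X = X + O(X ^ 2)`. -/
def iterateCoeff (φ : K⟦X⟧) (k : ℕ) : Polynomial K :=
  ∑ i ∈ Finset.range (k + 1),
    Polynomial.C ((i.factorial : K)⁻¹ * coeff k (((ρ.toLinearMap - 1) ^ i) φ)) * descPochhammer K i

variable [CharZero K]

theorem iterateCoeff_eval_natCast (hρ : X ^ 2 ∣ ρ X - X) (φ : K⟦X⟧) (k n : ℕ) :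
    (iterateCoeff ρ φ k).eval (n : K) = coeff k ((ρ ^ n) φ) := by
  have hterm : ∀ i, (Polynomial.C ((i.factorial : K)⁻¹ *
      coeff k (((ρ.toLinearMap - 1) ^ i) φ)) * descPochhammer K i).eval (n : K) =
        n.choose i * coeff k (((ρ.toLinearMap - 1) ^ i) φ) := by
    intro i
    rw [Polynomial.eval_mul, Polynomial.eval_C, descPochhammer_eval_eq_descFactorial,
      Nat.descFactorial_eq_factorial_mul_choose, Nat.cast_mul]
    field_simp [Nat.cast_ne_zero.2 i.factorial_ne_zero]
  have hpow : (ρ ^ n) φ = ((ρ.toLinearMap - 1 + 1) ^ n) φ := by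
    rw [sub_add_cancel, Module.End.pow_apply, AlgHom.coe_pow]; rfl
  have hbinom : coeff k ((ρ ^ n) φ) =
      ∑ i ∈ Finset.range (n + 1), n.choose i * coeff k (((ρ.toLinearMap - 1) ^ i) φ) := by
    rw [hpow, (Commute.one_right _).add_pow]
    simp [LinearMap.sum_apply, ← nsmul_eq_mul, ← nsmul_eq_mul']
  rw [iterateCoeff, Polynomial.eval_finsetSum, hbinom]
  simp only [hterm]
  rcases le_total k n with hkn | hnk
  · refine (Finset.sum_subset (Finset.range_subset_range.2 (by lia)) fun i _ hi => ?_)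
    rw [X_pow_dvd_iff.1 (X_pow_dvd_sub_one_pow_apply hρ φ i) k (by simpa using hi), mul_zero]
  · refine (Finset.sum_subset (Finset.range_subset_range.2 (by lia)) fun i _ hi => ?_).symm
    rw [Nat.choose_eq_zero_of_lt (by simpa using hi), Nat.cast_zero, zero_mul]

theorem iterateCoeff_eval_zero (hρ : X ^ 2 ∣ ρ X - X) (φ : K⟦X⟧) (k : ℕ) :
    (iterateCoeff ρ φ k).eval 0 = coeff k φ := by
  simpa using iterateCoeff_eval_natCast hρ φ k 0

theorem iterateCoeff_add (hρ : X ^ 2 ∣ ρ X - X) (φ ψ : K⟦X⟧) (k : ℕ) :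
    iterateCoeff ρ (φ + ψ) k = iterateCoeff ρ φ k + iterateCoeff ρ ψ k :=
  polynomial_ext_natCast fun n => by simp [iterateCoeff_eval_natCast hρ]

theorem iterateCoeff_mul (hρ : X ^ 2 ∣ ρ X - X) (φ ψ : K⟦X⟧) (k : ℕ) :
    iterateCoeff ρ (φ * ψ) k =
      ∑ p ∈ Finset.HasAntidiagonal.antidiagonal k, iterateCoeff ρ φ p.1 * iterateCoeff ρ ψ p.2 :=
  polynomial_ext_natCast fun n => by
    simp [iterateCoeff_eval_natCast hρ, Polynomial.eval_finsetSum, coeff_mul]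

theorem iterateCoeff_algebraMap (hρ : X ^ 2 ∣ ρ X - X) (c : K) (k : ℕ) :
    iterateCoeff ρ (algebraMap K K⟦X⟧ c) k = Polynomial.C (coeff k (algebraMap K K⟦X⟧ c)) :=
  polynomial_ext_natCast fun n => by
    rw [iterateCoeff_eval_natCast hρ, AlgHom.commutes, Polynomial.eval_C]

theorem iterateCoeff_smul (hρ : X ^ 2 ∣ ρ X - X) (c : K) (φ : K⟦X⟧) (k : ℕ) :
    iterateCoeff ρ (c • φ) k = c • iterateCoeff ρ φ k :=
  polynomial_ext_natCast fun n => by simp [iterateCoeff_eval_natCast hρ]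

theorem iterateCoeff_algHom_apply (hρ : X ^ 2 ∣ ρ X - X) (hσ : X ∣ σ X) (hρσ : Commute ρ σ)
    (φ : K⟦X⟧) (k : ℕ) :
    iterateCoeff ρ (σ φ) k =
      ∑ i ∈ Finset.range (k + 1), iterateCoeff ρ φ i * Polynomial.C (coeff k (σ X ^ i)) :=
  polynomial_ext_natCast fun n => by
    have hcomm : (ρ ^ n) (σ φ) = σ ((ρ ^ n) φ) := DFunLike.congr_fun (hρσ.pow_left n).eq φ
    simp [iterateCoeff_eval_natCast hρ, Polynomial.eval_finsetSum, hcomm, coeff_algHom hσ]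

theorem iterateCoeff_pow_apply (hρ : X ^ 2 ∣ ρ X - X) (φ : K⟦X⟧) (k n : ℕ) :
    iterateCoeff ρ ((ρ ^ n) φ) k =
      (iterateCoeff ρ φ k).comp (Polynomial.X + Polynomial.C (n : K)) :=
  polynomial_ext_natCast fun m => by
    rw [Polynomial.eval_comp, Polynomial.eval_add, Polynomial.eval_X, Polynomial.eval_C,
      ← Nat.cast_add, iterateCoeff_eval_natCast hρ, iterateCoeff_eval_natCast hρ, pow_add,
      AlgHom.mul_apply]

theorem iterateCoeff_X_of_le (hρ : X ^ (j + 1) ∣ ρ X - X) (hj : 1 ≤ j) (hk : k ≤ j) :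
    iterateCoeff ρ X k = Polynomial.C (coeff k X) :=
  polynomial_ext_natCast fun n => by
    rw [iterateCoeff_eval_natCast ((pow_dvd_pow X (by lia)).trans hρ), Polynomial.eval_C,
      ← sub_eq_zero, ← map_sub]
    exact X_pow_dvd_iff.1 (X_pow_dvd_pow_apply_X_sub hρ hj n) k (by lia)

theorem iterateCoeff_X_succ (hρ : X ^ (j + 1) ∣ ρ X - X) (hj : 1 ≤ j) :
    iterateCoeff ρ X (j + 1) = Polynomial.X * Polynomial.C (coeff (j + 1) (ρ X)) :=
  polynomial_ext_natCast fun n => by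
    rw [iterateCoeff_eval_natCast ((pow_dvd_pow X (by lia)).trans hρ), coeff_pow_apply_X hρ hj n,
      Polynomial.eval_mul, Polynomial.eval_X, Polynomial.eval_C]

/-- The one-parameter group `ρᵗ`, for `t` in the field, through an endomorphism `ρ` with
`ρ X = X + O(X ^ 2)`, obtained by evaluating the polynomials `iterateCoeff` at `t`. -/
def flow (hρ : X ^ 2 ∣ ρ X - X) (t : K) : K⟦X⟧ →ₐ[K] K⟦X⟧ where
  toFun φ := mk fun k => (iterateCoeff ρ φ k).eval t
  map_one' := by
    ext k
    rw [← map_one (algebraMap K K⟦X⟧), coeff_mk, iterateCoeff_algebraMap hρ, Polynomial.eval_C]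
  map_mul' φ ψ := by
    ext k
    simp [iterateCoeff_mul hρ, Polynomial.eval_finsetSum, coeff_mul]
  map_zero' := by
    ext k
    rw [← map_zero (algebraMap K K⟦X⟧), coeff_mk, iterateCoeff_algebraMap hρ, Polynomial.eval_C]
  map_add' φ ψ := by
    ext k
    simp [iterateCoeff_add hρ]
  commutes' c := by
    ext k
    rw [coeff_mk, iterateCoeff_algebraMap hρ, Polynomial.eval_C]

theorem coeff_flow (hρ : X ^ 2 ∣ ρ X - X) (t : K) (φ : K⟦X⟧) (k : ℕ) :
    coeff k (flow hρ t φ) = (iterateCoeff ρ φ k).eval t :=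
  coeff_mk k fun k => (iterateCoeff ρ φ k).eval t

theorem commute_flow (hρ : X ^ 2 ∣ ρ X - X) (hσ : X ∣ σ X) (hρσ : Commute ρ σ) (t : K) :
    Commute σ (flow hρ t) := by
  ext φ k
  simp [AlgHom.mul_apply, coeff_algHom hσ, coeff_flow, iterateCoeff_algHom_apply hρ hσ hρσ,
    Polynomial.eval_finsetSum]

theorem X_pow_dvd_flow_X_sub (hρ : X ^ 2 ∣ ρ X - X) (hj : 1 ≤ j) (h : X ^ (j + 1) ∣ ρ X - X)
    (t : K) : X ^ (j + 1) ∣ flow hρ t X - X := by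
  rw [X_pow_dvd_iff]
  intro k hk
  rw [map_sub, coeff_flow, iterateCoeff_X_of_le h hj (by lia), Polynomial.eval_C, sub_self]

theorem coeff_flow_X (hρ : X ^ 2 ∣ ρ X - X) (hj : 1 ≤ j) (h : X ^ (j + 1) ∣ ρ X - X) (t : K) :
    coeff (j + 1) (flow hρ t X) = t * coeff (j + 1) (ρ X) := by
  rw [coeff_flow, iterateCoeff_X_succ h hj, Polynomial.eval_mul, Polynomial.eval_X,
    Polynomial.eval_C]

theorem exists_flow_eq_of_commute (hρ : X ^ 2 ∣ ρ X - X) (hj : 1 ≤ j) (h : X ^ (j + 1) ∣ ρ X - X)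
    (h0 : coeff (j + 1) (ρ X) ≠ 0) (hσ : X ^ (j + 1) ∣ σ X - X) (hρσ : Commute ρ σ) :
    ∃ t, flow hρ t = σ := by
  have hσ2 : X ^ 2 ∣ σ X - X := (pow_dvd_pow X (by lia)).trans hσ
  refine ⟨coeff (j + 1) (σ X) / coeff (j + 1) (ρ X), algHom_eq_of_commute hj h h0
    (X_pow_dvd_flow_X_sub hρ le_rfl hρ _) hσ2
    (commute_flow hρ (X_dvd_of_X_sq_dvd_sub_X hρ) (Commute.refl ρ) _) hρσ ?_⟩
  set t := coeff (j + 1) (σ X) / coeff (j + 1) (ρ X)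
  have hdvd : X ^ (j + 1) ∣ flow hρ t X - σ X := by
    simpa using (X_pow_dvd_flow_X_sub hρ hj h t).sub hσ
  have hcoeff : coeff (j + 1) (flow hρ t X - σ X) = 0 := by
    rw [map_sub, coeff_flow_X hρ hj h, div_mul_cancel₀ _ h0, sub_self]
  simpa [hcoeff] using X_pow_succ_dvd_sub hdvd

theorem flow_one (hρ : X ^ 2 ∣ ρ X - X) : flow hρ 1 = ρ := by
  ext φ k
  simpa [coeff_flow] using iterateCoeff_eval_natCast hρ φ k 1

/-- The infinitesimal generator `d/dt ρᵗ` at `t = 0` of the one-parameter group `flow`. -/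
def generator (hρ : X ^ 2 ∣ ρ X - X) : Derivation K K⟦X⟧ K⟦X⟧ :=
  Derivation.mk'
    { toFun := fun φ => mk fun k => (iterateCoeff ρ φ k).derivative.eval 0
      map_add' := fun φ ψ => by ext k; simp [iterateCoeff_add hρ]
      map_smul' := fun c φ => by ext k; simp [iterateCoeff_smul hρ] }
    fun φ ψ => by
      rw [smul_eq_mul, smul_eq_mul, mul_comm ψ]
      ext k
      simp [iterateCoeff_mul hρ, Polynomial.eval_finsetSum, iterateCoeff_eval_zero hρ, coeff_mul,
        Finset.sum_add_distrib, add_comm]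

theorem coeff_generator (hρ : X ^ 2 ∣ ρ X - X) (φ : K⟦X⟧) (k : ℕ) :
    coeff k (generator hρ φ) = (iterateCoeff ρ φ k).derivative.eval 0 :=
  coeff_mk k fun k => (iterateCoeff ρ φ k).derivative.eval 0

theorem X_sq_dvd_generator_X (hρ : X ^ 2 ∣ ρ X - X) : X ^ 2 ∣ generator hρ X := by
  rw [X_pow_dvd_iff]
  intro k hk
  rw [coeff_generator, iterateCoeff_X_of_le hρ le_rfl (by lia), Polynomial.derivative_C,
    Polynomial.eval_zero]

theorem derivative_iterateCoeff (hρ : X ^ 2 ∣ ρ X - X) (φ : K⟦X⟧) (k : ℕ) :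
    (iterateCoeff ρ φ k).derivative = iterateCoeff ρ (generator hρ φ) k :=
  polynomial_ext_natCast fun n => by
    have hX : X ∣ (ρ ^ n) X := X_dvd_of_X_sq_dvd_sub_X (X_pow_dvd_pow_apply_X_sub hρ le_rfl n)
    calc (iterateCoeff ρ φ k).derivative.eval (n : K)
        = (iterateCoeff ρ ((ρ ^ n) φ) k).derivative.eval 0 := by
          simp [iterateCoeff_pow_apply hρ, Polynomial.derivative_comp, -AlgHom.coe_pow]
      _ = coeff k ((ρ ^ n) (generator hρ φ)) := by
          simp [iterateCoeff_algHom_apply hρ hX (Commute.self_pow ρ n), Polynomial.eval_finsetSum,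
            coeff_algHom hX, coeff_generator, -AlgHom.coe_pow]
      _ = (iterateCoeff ρ (generator hρ φ) k).eval (n : K) :=
          (iterateCoeff_eval_natCast hρ _ _ _).symm

theorem coeff_iterateCoeff (hρ : X ^ 2 ∣ ρ X - X) (φ : K⟦X⟧) (k n : ℕ) :
    (iterateCoeff ρ φ k).coeff n = coeff k ((generator hρ)^[n] φ) / n.factorial := by
  have hiter : Polynomial.derivative^[n] (iterateCoeff ρ φ k) =
      iterateCoeff ρ ((generator hρ)^[n] φ) k := by
    induction n with
    | zero => rfl
    | succ n ih =>
      rw [Function.iterate_succ_apply', Function.iterate_succ_apply', ih,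
        derivative_iterateCoeff hρ]
  rw [← iterateCoeff_eval_zero hρ, ← hiter, ← Polynomial.coeff_zero_eq_eval_zero,
    Polynomial.coeff_iterate_derivative, zero_add, Nat.descFactorial_self, nsmul_eq_mul,
    mul_div_cancel_left₀ _ (Nat.cast_ne_zero.2 n.factorial_ne_zero)]

theorem isExp_flow {ρ : ℂ⟦X⟧ →ₐ[ℂ] ℂ⟦X⟧} (hρ : X ^ 2 ∣ ρ X - X) (t : ℂ) :
    IsExp t (generator hρ X) (flow hρ t X) := by
  intro k
  have hL : vectorField (generator hρ X) = generator hρ :=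
    funext fun φ => (derivation_eq_mul_derivative _ φ).symm
  rw [hL, coeff_flow, Polynomial.eval_eq_sum_range]
  have hterm : ∀ n, t ^ n / n.factorial * coeff k ((generator hρ)^[n] X) =
      (iterateCoeff ρ X k).coeff n * t ^ n := by
    intro n; rw [coeff_iterateCoeff hρ]; ring
  simp only [hterm]
  refine hasSum_sum_of_ne_finset_zero fun n hn => ?_
  rw [Polynomial.coeff_eq_zero_of_natDegree_lt (by simpa using hn), zero_mul]

end Flow

section TaylorSeries

open PowerSeries

variable {𝕜 : Type*} [NontriviallyNormedField 𝕜] {f g : 𝕜 → 𝕜}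

/-- The Taylor series at `0` of a function; `Diff.taylor` is its value at a representative. -/
def taylorSeries (f : 𝕜 → 𝕜) : 𝕜⟦X⟧ :=
  mk fun k => iteratedDeriv k f 0 / (k.factorial : 𝕜)

theorem coeff_taylorSeries (f : 𝕜 → 𝕜) (k : ℕ) :
    coeff k (taylorSeries f) = iteratedDeriv k f 0 / k.factorial :=
  coeff_mk _ _

theorem coeff_zero_taylorSeries (f : 𝕜 → 𝕜) : coeff 0 (taylorSeries f) = f 0 := by
  simp [coeff_taylorSeries]

theorem coeff_one_taylorSeries (f : 𝕜 → 𝕜) : coeff 1 (taylorSeries f) = deriv f 0 := by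
  simp [coeff_taylorSeries]

theorem taylorSeries_congr (h : f =ᶠ[𝓝 0] g) : taylorSeries f = taylorSeries g := by
  ext k
  rw [coeff_taylorSeries, coeff_taylorSeries, h.iteratedDeriv_eq k]

theorem taylorSeries_const (c : 𝕜) : taylorSeries (fun _ => c) = C c := by
  ext k
  rw [coeff_taylorSeries, iteratedDeriv_const, coeff_C]
  split_ifs with h <;> simp [h]

theorem taylorSeries_id : taylorSeries (fun z : 𝕜 => z) = X := by
  ext k
  rw [coeff_taylorSeries, iteratedDeriv_fun_id_zero, coeff_X]
  split_ifs with h <;> simp [h]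

theorem hasSubst_taylorSeries (h0 : g 0 = 0) : HasSubst (taylorSeries g) :=
  HasSubst.of_constantCoeff_zero' <| by
    rw [← coeff_zero_eq_constantCoeff_apply, coeff_zero_taylorSeries, h0]

theorem analyticAt_dslope {z : 𝕜} (hf : AnalyticAt 𝕜 f z) : AnalyticAt 𝕜 (dslope f z) z := by
  obtain ⟨p, hp⟩ := hf
  exact hp.has_fpower_series_dslope_fslope.analyticAt

variable [CompleteSpace 𝕜]

theorem taylorSeries_add (hf : AnalyticAt 𝕜 f 0) (hg : AnalyticAt 𝕜 g 0) :
    taylorSeries (fun z => f z + g z) = taylorSeries f + taylorSeries g := by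
  ext k
  rw [map_add, coeff_taylorSeries, coeff_taylorSeries, coeff_taylorSeries,
    iteratedDeriv_fun_add hf.contDiffAt hg.contDiffAt, add_div]

variable [CharZero 𝕜]

theorem taylorSeries_mul (hf : AnalyticAt 𝕜 f 0) (hg : AnalyticAt 𝕜 g 0) :
    taylorSeries (fun z => f z * g z) = taylorSeries f * taylorSeries g := by
  ext k
  rw [coeff_mul, Finset.Nat.sum_antidiagonal_eq_sum_range_succ_mk, coeff_taylorSeries,
    iteratedDeriv_fun_mul hf.contDiffAt hg.contDiffAt, Finset.sum_div]
  refine Finset.sum_congr rfl fun i hi => ?_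
  have hfact : ∀ m : ℕ, (m.factorial : 𝕜) ≠ 0 := fun m => Nat.cast_ne_zero.2 m.factorial_ne_zero
  rw [coeff_taylorSeries, coeff_taylorSeries,
    Nat.cast_choose 𝕜 (Nat.lt_succ_iff.1 (Finset.mem_range.1 hi))]
  field_simp [hfact]

theorem taylorSeries_pow_mul (hf : AnalyticAt 𝕜 f 0) (n : ℕ) :
    taylorSeries (fun z => z ^ n * f z) = X ^ n * taylorSeries f := by
  induction n with
  | zero => simp
  | succ n ih =>
    have hid : AnalyticAt 𝕜 (fun z : 𝕜 => z) 0 := analyticAt_id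
    simp only [_root_.pow_succ', mul_assoc]
    rw [taylorSeries_mul hid ((hid.fun_pow n).fun_mul hf), taylorSeries_id, ih]

theorem taylorSeries_comp_eq_add_mul (hf : AnalyticAt 𝕜 f 0) (hg : AnalyticAt 𝕜 g 0)
    (h0 : g 0 = 0) : taylorSeries (fun z => f (g z)) =
      C (f 0) + taylorSeries g * taylorSeries (fun z => dslope f 0 (g z)) := by
  have hfg : (fun z => f (g z)) = fun z => f 0 + g z * dslope f 0 (g z) := by
    ext z
    have := sub_smul_dslope f 0 (g z)
    rw [sub_zero, smul_eq_mul] at this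
    rw [this]; ring
  have hd : AnalyticAt 𝕜 (fun z => dslope f 0 (g z)) 0 :=
    AnalyticAt.fun_comp (by rw [h0]; exact analyticAt_dslope hf) hg
  rw [hfg, taylorSeries_add analyticAt_const (hg.fun_mul hd), taylorSeries_const,
    taylorSeries_mul hg hd]

theorem taylorSeries_comp (hf : AnalyticAt 𝕜 f 0) (hg : AnalyticAt 𝕜 g 0) (h0 : g 0 = 0) :
    taylorSeries (fun z => f (g z)) =
      substAlgHom (R := 𝕜) (hasSubst_taylorSeries h0) (taylorSeries f) := by
  set σ : 𝕜⟦X⟧ →ₐ[𝕜] 𝕜⟦X⟧ := substAlgHom (R := 𝕜) (hasSubst_taylorSeries h0)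
  have hσX : σ X = taylorSeries g := substAlgHom_X _
  suffices H : ∀ (n : ℕ) (f : 𝕜 → 𝕜), AnalyticAt 𝕜 f 0 →
      X ^ n ∣ taylorSeries (fun z => f (g z)) - σ (taylorSeries f) from
    sub_eq_zero.1 (eq_zero_of_forall_X_pow_dvd fun n => H n f hf)
  intro n
  induction n with
  | zero => simp
  | succ n ih =>
    intro f hf
    have hX : X ∣ taylorSeries g := by
      rw [X_dvd_iff, ← coeff_zero_eq_constantCoeff_apply, coeff_zero_taylorSeries, h0]
    have hσC : σ (C (f 0)) = C (f 0) := σ.commutes _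
    have hσf : σ (taylorSeries f) =
        C (f 0) + taylorSeries g * σ (taylorSeries (dslope f 0)) := by
      have hid : AnalyticAt 𝕜 (fun z : 𝕜 => z) 0 := analyticAt_id
      have hfX := taylorSeries_comp_eq_add_mul hf hid rfl
      rw [taylorSeries_id] at hfX
      rw [hfX, map_add, map_mul, hσX, hσC]
    rw [taylorSeries_comp_eq_add_mul hf hg h0, hσf, add_sub_add_left_eq_sub, ← mul_sub,
      _root_.pow_succ']
    exact mul_dvd_mul hX (ih _ (analyticAt_dslope hf))

end TaylorSeries

section Jet

variable {𝕜 : Type*} [NontriviallyNormedField 𝕜] {j : ℕ} {β γ : 𝕜} {F H : 𝕜 → 𝕜}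

/-- `F z = 1 + β z ^ j + o(z ^ j)` as `z → 0` with `z ≠ 0`. -/
def HasJet (j : ℕ) (β : 𝕜) (F : 𝕜 → 𝕜) : Prop :=
  Tendsto (fun z => (F z - 1) / z ^ j) (𝓝[≠] 0) (𝓝 β)

theorem tendsto_pow_nhdsNE_zero (hj : 1 ≤ j) :
    Tendsto (fun z : 𝕜 => z ^ j) (𝓝[≠] 0) (𝓝 0) := by
  have h := (continuous_pow (M := 𝕜) j).tendsto 0
  rw [zero_pow (by lia)] at h
  exact h.mono_left nhdsWithin_le_nhds

theorem HasJet.congr (hF : HasJet j β F) (h : F =ᶠ[𝓝[≠] 0] H) : HasJet j β H :=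
  Tendsto.congr' (h.mono fun z hz => by rw [hz]) hF

theorem HasJet.tendsto_one (hj : 1 ≤ j) (hF : HasJet j β F) : Tendsto F (𝓝[≠] 0) (𝓝 1) := by
  have h := (hF.mul (tendsto_pow_nhdsNE_zero hj)).add_const 1
  rw [mul_zero, zero_add] at h
  refine h.congr' (eventually_mem_nhdsWithin.mono fun z (hz : z ≠ 0) => ?_)
  rw [div_mul_cancel₀ _ (pow_ne_zero j hz), sub_add_cancel]

theorem HasJet.mul (hj : 1 ≤ j) (hF : HasJet j β F) (hH : HasJet j γ H) :
    HasJet j (β + γ) (fun z => F z * H z) := by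
  have h := (Tendsto.mul hF (hH.tendsto_one hj)).add hH
  rw [mul_one] at h
  exact h.congr fun z => by ring

theorem HasJet.comp (hj : 1 ≤ j) (hF : HasJet j β F) {ϕ : 𝕜 → 𝕜} {d : 𝕜}
    (hϕ : HasDerivAt ϕ d 1) (h1 : ϕ 1 = 1) : HasJet j (d * β) (fun z => ϕ (F z)) := by
  have hslope := (continuousAt_dslope_same.2 hϕ.differentiableAt).tendsto.comp (hF.tendsto_one hj)
  rw [dslope_same, hϕ.deriv] at hslope
  refine (hslope.mul hF).congr fun z => ?_
  have h : (F z - 1) * dslope ϕ 1 (F z) = ϕ (F z) - 1 := by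
    rw [← smul_eq_mul, sub_smul_dslope, h1]
  rw [Function.comp_apply, ← h]
  ring

theorem HasJet.zpow (hj : 1 ≤ j) (hF : HasJet j β F) (n : ℤ) :
    HasJet j (n * β) (fun z => F z ^ n) := by
  simpa using hF.comp hj (hasDerivAt_zpow n 1 (Or.inl one_ne_zero)) (one_zpow n)

end Jet

section Contact

variable {𝕜 : Type*} [NontriviallyNormedField 𝕜] {j : ℕ} {β : 𝕜} {f u w S : 𝕜 → 𝕜}

/-- The germ of `f` at `0` is analytic, of the form `z + β z ^ (j + 1) + ⋯` with `1 ≤ j`. -/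
structure HasContact (j : ℕ) (β : 𝕜) (f : 𝕜 → 𝕜) : Prop where
  one_le : 1 ≤ j
  exists_analyticAt :
    ∃ u, AnalyticAt 𝕜 u 0 ∧ u 0 = β ∧ (fun z => f z - z) =ᶠ[𝓝 0] fun z => z ^ (j + 1) * u z

theorem HasContact.analyticAt (h : HasContact j β f) : AnalyticAt 𝕜 f 0 := by
  obtain ⟨u, hu, -, e⟩ := h.exists_analyticAt
  have hid : AnalyticAt 𝕜 (fun z : 𝕜 => z) 0 := analyticAt_id
  refine (hid.fun_add ((hid.fun_pow (j + 1)).fun_mul hu)).congr (e.mono fun z hz => ?_)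
  exact (sub_eq_iff_eq_add'.1 hz).symm

theorem exists_pow_mul_iteratedDeriv_pow_mul [CompleteSpace 𝕜] (hu : AnalyticAt 𝕜 u 0)
    (k n : ℕ) : ∃ v, AnalyticAt 𝕜 v 0 ∧ v 0 = k.descFactorial n * u 0 ∧
      ∀ᶠ z in 𝓝 0, z ^ n * iteratedDeriv n (fun z => z ^ k * u z) z = z ^ k * v z := by
  induction n with
  | zero => exact ⟨u, hu, by simp, by simp⟩
  | succ n ih =>
    obtain ⟨v, hv, hv0, e⟩ := ih
    have hid : AnalyticAt 𝕜 (fun z : 𝕜 => z) 0 := analyticAt_id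
    have hF : AnalyticAt 𝕜 (iteratedDeriv n fun z => z ^ k * u z) 0 := by
      rw [iteratedDeriv_eq_iterate]
      exact AnalyticAt.iterated_deriv ((hid.fun_pow k).fun_mul hu) n
    refine ⟨fun z => (k - n) * v z + z * deriv v z, by fun_prop, ?_, ?_⟩
    · simp only [zero_mul, add_zero, hv0, Nat.descFactorial_succ, Nat.cast_mul]
      obtain hkn | hkn := lt_or_ge k n
      · simp [Nat.descFactorial_of_lt hkn]
      · rw [Nat.cast_sub hkn, mul_assoc]
    · filter_upwards [EventuallyEq.deriv e, e, hF.eventually_analyticAt, hv.eventually_analyticAt]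
        with z hderiv hz hFz hvz
      have hpow : ∀ m : ℕ, z * (m * z ^ (m - 1)) = m * z ^ m := fun m => by
        rcases m with _ | m
        · simp
        · rw [Nat.add_sub_cancel]; ring
      rw [deriv_fun_mul (by fun_prop) hFz.differentiableAt,
        deriv_fun_mul (by fun_prop) hvz.differentiableAt, deriv_pow_field, deriv_pow_field,
        ← iteratedDeriv_succ] at hderiv
      linear_combination z * hderiv - n * hz - iteratedDeriv n (fun z => z ^ k * u z) z * hpow n
        + v z * hpow k

theorem HasContact.tendsto_iteratedDeriv_sub [CompleteSpace 𝕜] (h : HasContact j β f) (n : ℕ) :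
    Tendsto (fun z => z ^ n * iteratedDeriv n (fun z => f z - z) z / z ^ (j + 1)) (𝓝[≠] 0)
      (𝓝 ((j + 1).descFactorial n * β)) := by
  obtain ⟨u, hu, rfl, e⟩ := h.exists_analyticAt
  obtain ⟨v, hv, hv0, ev⟩ := exists_pow_mul_iteratedDeriv_pow_mul hu (j + 1) n
  rw [← hv0]
  refine (hv.continuousAt.tendsto.mono_left nhdsWithin_le_nhds).congr' ?_
  filter_upwards [nhdsWithin_le_nhds ev, nhdsWithin_le_nhds (e.iteratedDeriv n),
    self_mem_nhdsWithin] with z hz he (hz0 : z ≠ 0)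
  rw [he, hz, mul_div_cancel_left₀ _ (pow_ne_zero _ hz0)]

theorem HasContact.tendsto_iteratedDeriv [CompleteSpace 𝕜] (h : HasContact j β f) {n : ℕ}
    (hn : 2 ≤ n) : Tendsto (fun z => z ^ n * iteratedDeriv n f z / z ^ (j + 1)) (𝓝[≠] 0)
      (𝓝 ((j + 1).descFactorial n * β)) := by
  refine (h.tendsto_iteratedDeriv_sub n).congr' ?_
  filter_upwards [nhdsWithin_le_nhds h.analyticAt.eventually_analyticAt] with z hz
  rw [iteratedDeriv_fun_sub hz.contDiffAt contDiff_fun_id.contDiffAt, iteratedDeriv_fun_id]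
  simp [show n ≠ 0 by lia, show n ≠ 1 by lia]

theorem HasContact.hasJet_div [CompleteSpace 𝕜] (h : HasContact j β f) :
    HasJet j β (fun z => f z / z) := by
  have h0 := h.tendsto_iteratedDeriv_sub 0
  simp only [pow_zero, one_mul, iteratedDeriv_zero, Nat.descFactorial_zero, Nat.cast_one] at h0
  refine h0.congr' (eventually_mem_nhdsWithin.mono fun z (hz : z ≠ 0) => ?_)
  field_simp
  ring

theorem HasContact.hasJet_deriv [CompleteSpace 𝕜] (h : HasContact j β f) :
    HasJet j ((j + 1) * β) (deriv f) := by
  have h1 := h.tendsto_iteratedDeriv_sub 1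
  rw [Nat.descFactorial_one, Nat.cast_add_one] at h1
  refine h1.congr' ?_
  filter_upwards [nhdsWithin_le_nhds h.analyticAt.eventually_analyticAt, self_mem_nhdsWithin]
    with z hz (hz0 : z ≠ 0)
  rw [iteratedDeriv_one, deriv_fun_sub hz.differentiableAt differentiableAt_fun_id, deriv_id'']
  field_simp
  ring

theorem HasContact.tendsto_nhdsNE [CompleteSpace 𝕜] (h : HasContact j β f) :
    Tendsto f (𝓝[≠] 0) (𝓝[≠] 0) := by
  have hdiv := h.hasJet_div.tendsto_one h.one_le
  refine tendsto_nhdsWithin_iff.2 ⟨?_, ?_⟩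
  · have h0 := hdiv.mul (tendsto_id.mono_left (nhdsWithin_le_nhds (a := (0 : 𝕜)) (s := {0}ᶜ)))
    rw [mul_zero] at h0
    refine h0.congr' (eventually_mem_nhdsWithin.mono fun z (hz : z ≠ 0) => ?_)
    exact div_mul_cancel₀ _ hz
  · filter_upwards [hdiv.eventually_ne one_ne_zero] with z hz h0
    exact hz (by rw [show f z = 0 from h0, zero_div])

theorem HasContact.hasJet_comp_div [CompleteSpace 𝕜] (h : HasContact j β f) {v : 𝕜 → 𝕜}
    (hv : AnalyticAt 𝕜 v 0) (hv0 : v 0 ≠ 0) : HasJet j 0 (fun z => v (f z) / v z) := by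
  have tv : Tendsto v (𝓝[≠] 0) (𝓝 (v 0)) :=
    hv.continuousAt.tendsto.mono_left nhdsWithin_le_nhds
  have hO : (fun z => v (f z) - v z) =O[𝓝[≠] 0] fun z => f z - z :=
    hv.hasStrictDerivAt.hasStrictFDerivAt.isBigO_sub.comp_tendsto
      ((h.tendsto_nhdsNE.mono_right nhdsWithin_le_nhds).prodMk_nhds nhdsWithin_le_nhds)
  have ho : (fun z => f z - z) =o[𝓝[≠] 0] fun z => z ^ j := by
    refine (Asymptotics.isLittleO_iff_tendsto' ?_).2 ?_
    · exact eventually_mem_nhdsWithin.mono fun z hz h => absurd h (pow_ne_zero _ hz)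
    · have h0 := (tendsto_pow_nhdsNE_zero le_rfl).mul h.hasJet_div
      rw [zero_mul] at h0
      refine h0.congr' (eventually_mem_nhdsWithin.mono fun z (hz : z ≠ 0) => ?_)
      field_simp
  have h0 := (hO.trans_isLittleO ho).tendsto_div_nhds_zero.div tv hv0
  rw [zero_div] at h0
  refine h0.congr' ((tv.eventually_ne hv0).mono fun z hz => ?_)
  simp only [Pi.div_apply]
  field_simp

theorem HasContact.hasJet_comp_div_mul_deriv_zpow [CompleteSpace 𝕜] (h : HasContact j β f)
    (hw : MeromorphicAt w 0) {k : ℤ} (hk : meromorphicOrderAt w 0 = k) (n : ℤ) :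
    HasJet j ((k + n * (j + 1)) * β) (fun z => w (f z) / w z * deriv f z ^ n) := by
  obtain ⟨v, hv, hv0, e⟩ := (meromorphicOrderAt_eq_int_iff hw).1 hk
  have hjet := ((h.hasJet_div.zpow h.one_le k).mul h.one_le (h.hasJet_comp_div hv hv0)).mul
    h.one_le (h.hasJet_deriv.zpow h.one_le n)
  rw [show (k + n * (j + 1)) * β = k * β + 0 + n * ((j + 1) * β) by ring]
  refine hjet.congr ?_
  filter_upwards [e, h.tendsto_nhdsNE.eventually e] with z h1 h2
  rw [h1, h2, sub_zero, sub_zero, smul_eq_mul, smul_eq_mul, div_zpow, mul_div_mul_comm]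

theorem HasContact.meromorphicOrderAt_of_invariant_form [CompleteSpace 𝕜] [CharZero 𝕜]
    (h : HasContact j β f) (hβ : β ≠ 0) (hw : MeromorphicAt w 0) {n : ℤ}
    (he : ∀ᶠ z in 𝓝[≠] 0, w (f z) * deriv f z ^ n = w z) :
    meromorphicOrderAt w 0 = ⊤ ∨ meromorphicOrderAt w 0 = (-(n * (j + 1)) : ℤ) := by
  refine or_iff_not_imp_left.2 fun htop => ?_
  obtain ⟨k, hk⟩ := WithTop.ne_top_iff_exists.1 htop
  have hone : HasJet j 0 (fun z => w (f z) / w z * deriv f z ^ n) := by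
    refine tendsto_const_nhds.congr' ?_
    filter_upwards [he, (meromorphicOrderAt_ne_top_iff_eventually_ne_zero hw).1 htop] with z hz hz0
    rw [div_mul_eq_mul_div, hz, div_self hz0, sub_self, zero_div]
  have h0 := tendsto_nhds_unique (h.hasJet_comp_div_mul_deriv_zpow hw hk.symm n) hone
  have hcoef : k + n * (j + 1) = 0 := by exact_mod_cast (mul_eq_zero.1 h0).resolve_right hβ
  rw [← hk, eq_neg_of_add_eq_zero_left hcoef]

theorem HasContact.eq_of_invariant_form [CompleteSpace 𝕜] [CharZero 𝕜] {j₁ j₂ : ℕ} {β₁ β₂ : 𝕜}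
    {f₁ f₂ : 𝕜 → 𝕜} (h₁ : HasContact j₁ β₁ f₁) (h₂ : HasContact j₂ β₂ f₂) (hβ₁ : β₁ ≠ 0)
    (hβ₂ : β₂ ≠ 0) (hw : MeromorphicAt w 0) (htop : meromorphicOrderAt w 0 ≠ ⊤) {n : ℤ}
    (hn : n ≠ 0) (he₁ : ∀ᶠ z in 𝓝[≠] 0, w (f₁ z) * deriv f₁ z ^ n = w z)
    (he₂ : ∀ᶠ z in 𝓝[≠] 0, w (f₂ z) * deriv f₂ z ^ n = w z) : j₁ = j₂ := by
  have ho₁ := (h₁.meromorphicOrderAt_of_invariant_form hβ₁ hw he₁).resolve_left htop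
  have ho₂ := (h₂.meromorphicOrderAt_of_invariant_form hβ₂ hw he₂).resolve_left htop
  rw [ho₁, WithTop.coe_inj, neg_inj] at ho₂
  have := mul_left_cancel₀ hn ho₂
  lia

theorem HasContact.eventually_eq_const_of_invariant_function [CompleteSpace 𝕜] [CharZero 𝕜]
    (h : HasContact j β f) (hβ : β ≠ 0) (hw : MeromorphicAt w 0)
    (he : ∀ᶠ z in 𝓝[≠] 0, w (f z) = w z) : ∃ c, ∀ᶠ z in 𝓝[≠] 0, w z = c := by
  have horder : ∀ c, meromorphicOrderAt (fun z => w z - c) 0 = ⊤ ∨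
      meromorphicOrderAt (fun z => w z - c) 0 = 0 := fun c => by
    simpa using h.meromorphicOrderAt_of_invariant_form hβ (hw.fun_sub (.const c 0)) (n := 0)
      (he.mono fun z hz => by rw [hz, zpow_zero, mul_one])
  obtain ⟨c, hc⟩ := tendsto_nhds_of_meromorphicOrderAt_nonneg hw
    (by obtain h0 | h0 := horder 0 <;> simp_all)
  have hpos : 0 < meromorphicOrderAt (fun z => w z - c) 0 := by
    rw [← tendsto_zero_iff_meromorphicOrderAt_pos (hw.fun_sub (.const c 0))]
    simpa using hc.sub_const c
  have htop := (horder c).resolve_right hpos.ne'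
  exact ⟨c, (meromorphicOrderAt_eq_top_iff.1 htop).mono fun z hz => sub_eq_zero.1 hz⟩

theorem eq_zero_of_tendsto_mul_of_order_neg {V W : 𝕜 → 𝕜} {a b : 𝕜}
    (hW : meromorphicOrderAt W 0 < 0) (hWV : Tendsto (fun z => W z * V z) (𝓝[≠] 0) (𝓝 a))
    (hV : Tendsto V (𝓝[≠] 0) (𝓝 b)) : b = 0 := by
  have hcob := tendsto_cobounded_of_meromorphicOrderAt_neg hW
  have h0 := (tendsto_inv₀_cobounded.comp hcob).mul hWV
  rw [zero_mul] at h0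
  refine tendsto_nhds_unique hV (h0.congr' ?_)
  exact (hcob.eventually_ne_cobounded 0).mono fun z hz => inv_mul_cancel_left₀ hz (V z)

theorem tendsto_zpow_mul_of_cocycle (hw : MeromorphicAt w 0) {n : ℤ}
    (htop : meromorphicOrderAt w 0 ≠ ⊤) {s : 𝕜}
    (hS : Tendsto (fun z => z ^ n * S z / z ^ j) (𝓝[≠] 0) (𝓝 s))
    (he : ∀ᶠ z in 𝓝[≠] 0, w (f z) * deriv f z ^ n + S z = w z) :
    Tendsto (fun z => z ^ n * w z * ((w (f z) / w z * deriv f z ^ n - 1) / z ^ j)) (𝓝[≠] 0)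
      (𝓝 (-s)) := by
  refine hS.neg.congr' ?_
  filter_upwards [he, (meromorphicOrderAt_ne_top_iff_eventually_ne_zero hw).1 htop] with z hz hz0
  rw [eq_sub_of_add_eq' hz]
  field_simp
  ring

theorem HasContact.eq_zero_of_cocycle_of_order_eq_top [CompleteSpace 𝕜] (h : HasContact j β f)
    (htop : meromorphicOrderAt w 0 = ⊤) {n : ℤ} {s : 𝕜}
    (hS : Tendsto (fun z => z ^ n * S z / z ^ j) (𝓝[≠] 0) (𝓝 s))
    (he : ∀ᶠ z in 𝓝[≠] 0, w (f z) * deriv f z ^ n + S z = w z) : s = 0 := by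
  have hw0 := meromorphicOrderAt_eq_top_iff.1 htop
  refine tendsto_nhds_unique hS (tendsto_const_nhds.congr' ?_)
  filter_upwards [he, hw0, h.tendsto_nhdsNE.eventually hw0] with z hz hwz hwfz
  have hSz : S z = 0 := by simpa [hwz, hwfz] using hz
  rw [hSz, mul_zero, zero_div]

theorem meromorphicOrderAt_zpow_mul (hw : MeromorphicAt w 0) (n : ℤ) :
    meromorphicOrderAt (fun z => z ^ n * w z) 0 = n + meromorphicOrderAt w 0 := by
  have hzpow : meromorphicOrderAt (fun z : 𝕜 => z ^ n) 0 = n := by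
    simpa using fun_meromorphicOrderAt_zpow_id_sub_const (x := (0 : 𝕜)) (n := n)
  rw [fun_meromorphicOrderAt_mul (by fun_prop) hw, hzpow]

theorem HasContact.meromorphicOrderAt_of_cocycle [CompleteSpace 𝕜] [CharZero 𝕜]
    (h : HasContact j β f) (hβ : β ≠ 0) (hw : MeromorphicAt w 0) {n : ℤ} (hn : n ≠ 0) {q : 𝕜}
    (hS : Tendsto (fun z => z ^ n * S z / z ^ j) (𝓝[≠] 0) (𝓝 (n * j * q * β)))
    (he : ∀ᶠ z in 𝓝[≠] 0, w (f z) * deriv f z ^ n + S z = w z) :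
    (((-n : ℤ) : WithTop ℤ) < meromorphicOrderAt w 0 ∧ q = 0) ∨
      (meromorphicOrderAt w 0 = (-n : ℤ) ∧ meromorphicTrailingCoeffAt w 0 = -q) ∨
      meromorphicOrderAt w 0 = (-(n * (j + 1)) : ℤ) := by
  have hj := h.one_le
  have hnj : (n * j : 𝕜) ≠ 0 := by exact_mod_cast mul_ne_zero hn (by lia : (j : ℤ) ≠ 0)
  rcases eq_or_ne (meromorphicOrderAt w 0) ⊤ with htop | htop
  · refine Or.inl ⟨htop ▸ WithTop.coe_lt_top _, ?_⟩
    have hs := h.eq_zero_of_cocycle_of_order_eq_top htop hS he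
    exact (mul_eq_zero.1 ((mul_eq_zero.1 hs).resolve_right hβ)).resolve_left hnj
  have hlim := tendsto_zpow_mul_of_cocycle hw htop hS he
  obtain ⟨k, hk⟩ := WithTop.ne_top_iff_exists.1 htop
  have hjet := h.hasJet_comp_div_mul_deriv_zpow hw hk.symm n
  have horder := meromorphicOrderAt_zpow_mul hw n
  rw [← hk] at horder ⊢
  rcases lt_trichotomy (n + k) 0 with hneg | hzero | hpos
  · have h0 := eq_zero_of_tendsto_mul_of_order_neg (by rw [horder]; exact_mod_cast hneg) hlim hjet
    have hcoef : k + n * (j + 1) = 0 := by exact_mod_cast (mul_eq_zero.1 h0).resolve_right hβ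
    exact Or.inr (Or.inr (by rw [eq_neg_of_add_eq_zero_left hcoef]))
  · obtain rfl : k = -n := by lia
    have htc := hw.tendsto_nhds_meromorphicTrailingCoeffAt
    simp only [← hk, sub_zero, WithTop.untop₀_coe, neg_neg] at htc
    have h0 := tendsto_nhds_unique hlim (htc.mul hjet)
    refine Or.inr (Or.inl ⟨rfl, mul_left_cancel₀ (mul_ne_zero hnj hβ) ?_⟩)
    push_cast at h0
    linear_combination -h0
  · have hW : Tendsto (fun z => z ^ n * w z) (𝓝[≠] 0) (𝓝 0) :=
      tendsto_zero_of_meromorphicOrderAt_pos (by rw [horder]; exact_mod_cast hpos)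
    have h0 := tendsto_nhds_unique hlim (hW.mul hjet)
    refine Or.inl ⟨by exact_mod_cast (by lia : -n < k), ?_⟩
    simpa [hnj, hβ] using h0

/- The D-groupoids `G₂` and `G₃` are given by cocycle relations `w(f) f' ^ n + S = w` with
`n = 1, 2`; in both cases the order and the trailing coefficient of `w` determine `q j`,
hence `j`. -/
theorem HasContact.eq_of_cocycle [CompleteSpace 𝕜] [CharZero 𝕜] {j₁ j₂ : ℕ} {β₁ β₂ : 𝕜}
    {f₁ f₂ S₁ S₂ : 𝕜 → 𝕜} (h₁ : HasContact j₁ β₁ f₁) (h₂ : HasContact j₂ β₂ f₂) (hβ₁ : β₁ ≠ 0)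
    (hβ₂ : β₂ ≠ 0) (hw : MeromorphicAt w 0) {n : ℤ} (hn : 0 < n) {q : ℕ → 𝕜}
    (hq : Function.Injective q)
    (hS₁ : Tendsto (fun z => z ^ n * S₁ z / z ^ j₁) (𝓝[≠] 0) (𝓝 (n * j₁ * q j₁ * β₁)))
    (hS₂ : Tendsto (fun z => z ^ n * S₂ z / z ^ j₂) (𝓝[≠] 0) (𝓝 (n * j₂ * q j₂ * β₂)))
    (he₁ : ∀ᶠ z in 𝓝[≠] 0, w (f₁ z) * deriv f₁ z ^ n + S₁ z = w z)
    (he₂ : ∀ᶠ z in 𝓝[≠] 0, w (f₂ z) * deriv f₂ z ^ n + S₂ z = w z) : j₁ = j₂ := by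
  have hlt : ∀ {j : ℕ} {β : 𝕜} {f : 𝕜 → 𝕜}, HasContact j β f → -(n * (j + 1)) < -n :=
    fun h => by nlinarith [h.one_le]
  have hlt₁ := hlt h₁
  have hlt₂ := hlt h₂
  obtain ⟨ho₁, hq₁⟩ | ⟨ho₁, hq₁⟩ | ho₁ := h₁.meromorphicOrderAt_of_cocycle hβ₁ hw hn.ne' hS₁ he₁ <;>
  obtain ⟨ho₂, hq₂⟩ | ⟨ho₂, hq₂⟩ | ho₂ := h₂.meromorphicOrderAt_of_cocycle hβ₂ hw hn.ne' hS₂ he₂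
  · exact hq (hq₁.trans hq₂.symm)
  · exact (ho₁.ne' ho₂).elim
  · rw [ho₂, WithTop.coe_lt_coe] at ho₁; lia
  · exact (ho₂.ne' ho₁).elim
  · exact hq (neg_injective (hq₁.symm.trans hq₂))
  · rw [ho₂, WithTop.coe_inj] at ho₁; lia
  · rw [ho₁, WithTop.coe_lt_coe] at ho₂; lia
  · rw [ho₂, WithTop.coe_inj] at ho₁; lia
  · rw [ho₂, WithTop.coe_inj, neg_inj] at ho₁
    have := mul_left_cancel₀ hn.ne' ho₁
    lia

theorem HasContact.tendsto_iteratedDeriv_two_div_deriv [CompleteSpace 𝕜] (h : HasContact j β f) :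
    Tendsto (fun z => z ^ (1 : ℤ) * (iteratedDeriv 2 f z / deriv f z) / z ^ j) (𝓝[≠] 0)
      (𝓝 ((1 : ℤ) * j * (j + 1) * β)) := by
  have h2 := (h.tendsto_iteratedDeriv le_rfl).div (h.hasJet_deriv.tendsto_one h.one_le) one_ne_zero
  have hcoef : (1 : ℤ) * j * (j + 1) * β = ((j + 1).descFactorial 2 : 𝕜) * β / 1 := by
    rw [Nat.cast_descFactorial_two]; push_cast; ring
  rw [hcoef]
  refine h2.congr' (eventually_mem_nhdsWithin.mono fun z (hz : z ≠ 0) => ?_)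
  simp only [Pi.div_apply, zpow_one]
  field_simp
  ring

theorem HasContact.tendsto_schwarzian [CompleteSpace 𝕜] (h : HasContact j β f) :
    Tendsto (fun z => z ^ (2 : ℤ) * (2 * (iteratedDeriv 3 f z / deriv f z)
      - 3 * (iteratedDeriv 2 f z / deriv f z) ^ 2) / z ^ j) (𝓝[≠] 0)
      (𝓝 ((2 : ℤ) * j * (j ^ 2 - 1) * β)) := by
  have hderiv := h.hasJet_deriv.tendsto_one h.one_le
  have h3 := (h.tendsto_iteratedDeriv (n := 3) (by lia)).div hderiv one_ne_zero
  have h2 := h.tendsto_iteratedDeriv_two_div_deriv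
  have hS := (h3.const_mul 2).sub
    (((tendsto_pow_nhdsNE_zero h.one_le).mul (h2.pow 2)).const_mul 3)
  have hcoef : (2 : ℤ) * j * (j ^ 2 - 1) * β =
      2 * (((j + 1).descFactorial 3 : 𝕜) * β / 1) - 3 * (0 * ((1 : ℤ) * j * (j + 1) * β) ^ 2) := by
    rw [Nat.succ_descFactorial_succ, Nat.cast_mul, Nat.cast_descFactorial_two]; push_cast; ring
  rw [hcoef]
  refine hS.congr' (eventually_mem_nhdsWithin.mono fun z (hz : z ≠ 0) => ?_)
  simp only [Pi.div_apply, zpow_ofNat]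
  field_simp
  ring

end Contact

section Identity

variable {𝕜 : Type*} [NontriviallyNormedField 𝕜] {U : Set 𝕜} {η : 𝕜 → 𝕜}

theorem eventually_eq_const_of_isPreconnected (hη : MeromorphicOn η U) (hU : IsPreconnected U)
    {x y c : 𝕜} (hx : x ∈ U) (hy : y ∈ U) (h : ∀ᶠ z in 𝓝[≠] x, η z = c) :
    ∀ᶠ z in 𝓝[≠] y, η z = c := by
  have hm : MeromorphicOn (fun z => η z - c) U := fun z hz => (hη z hz).fun_sub (.const c z)
  have horder : ∀ z, meromorphicOrderAt (fun z => η z - c) z = ⊤ ↔ ∀ᶠ z in 𝓝[≠] z, η z = c :=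
    fun z => by simp only [meromorphicOrderAt_eq_top_iff, sub_eq_zero]
  rw [← horder] at h ⊢
  contrapose! h
  exact hm.meromorphicOrderAt_ne_top_of_isPreconnected hU hy hx h

end Identity

section DGroupoid

variable {r : ℝ}

theorem autDisc_subset_sol_of_eventually_eq_const {D : DGroupoid r} {η : ℂ → ℂ}
    (hη : MeromorphicOn η (Metric.ball 0 r)) {c : ℂ} (hc : ∀ᶠ z in 𝓝[≠] 0, η z = c)
    (hD : ∀ f z, η z = c → η (f z) = c → D.Equation f z) : autDisc r ⊆ D.sol := by
  rintro ⟨x, f⟩ ⟨hx, hf, hfx, hf'⟩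
  have h0 : (0 : ℂ) ∈ Metric.ball (0 : ℂ) r := Metric.mem_ball_self (Metric.pos_of_mem_ball hx)
  have hconst : ∀ y ∈ Metric.ball (0 : ℂ) r, ∀ᶠ z in 𝓝[≠] y, η z = c := fun y hy =>
    eventually_eq_const_of_isPreconnected hη (convex_ball _ _).isPreconnected h0 hy hc
  refine ⟨⟨hx, hf, hfx, hf'⟩, ?_⟩
  filter_upwards [hconst x hx,
    (hf.differentiableAt.hasDerivAt.tendsto_nhdsNE hf').eventually (hconst (f x) hfx)]
    with z hz hfz
  exact hD f z hz hfz

variable {j₁ j₂ : ℕ} {β₁ β₂ : ℂ} {f₁ f₂ : ℂ → ℂ}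

theorem DGroupoid.contact_order_unique {D : DGroupoid r} (hD : ¬ autDisc r ⊆ D.sol)
    (h₁ : HasContact j₁ β₁ f₁) (h₂ : HasContact j₂ β₂ f₂) (hβ₁ : β₁ ≠ 0) (hβ₂ : β₂ ≠ 0)
    (hf₁ : (0, f₁) ∈ D.sol) (hf₂ : (0, f₂) ∈ D.sol) : j₁ = j₂ := by
  have hmem : (0 : ℂ) ∈ Metric.ball (0 : ℂ) r := hf₁.1.1
  have he₁ := hf₁.2
  have he₂ := hf₂.2
  cases D with
  | order0 h hh =>
    have hm : MeromorphicOn h (Metric.ball 0 r) :=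
      fun z hz => (hh.analyticAt (Metric.isOpen_ball.mem_nhds hz)).meromorphicAt
    obtain ⟨c, hc⟩ := h₁.eventually_eq_const_of_invariant_function hβ₁ (hm 0 hmem)
      (he₁.mono fun z hz => (sub_eq_zero.1 hz).symm)
    exact absurd (autDisc_subset_sol_of_eventually_eq_const hm hc fun f z hz hfz => by
      rw [DGroupoid.Equation, hz, hfz, sub_self]) hD
  | order1 n η hη =>
    have hinv₁ := he₁.mono fun z hz => sub_eq_zero.1 hz
    have hinv₂ := he₂.mono fun z hz => sub_eq_zero.1 hz
    rcases eq_or_ne n 0 with rfl | hn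
    · obtain ⟨c, hc⟩ := h₁.eventually_eq_const_of_invariant_function hβ₁ (hη 0 hmem)
        (hinv₁.mono fun z hz => by rwa [zpow_zero, mul_one] at hz)
      exact absurd (autDisc_subset_sol_of_eventually_eq_const hη hc fun f z hz hfz => by
        rw [DGroupoid.Equation, hz, hfz, zpow_zero, mul_one, sub_self]) hD
    refine h₁.eq_of_invariant_form h₂ hβ₁ hβ₂ (hη 0 hmem) (fun htop => hD ?_) hn hinv₁ hinv₂
    exact autDisc_subset_sol_of_eventually_eq_const hη (meromorphicOrderAt_eq_top_iff.1 htop)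
      fun f z hz hfz => by rw [DGroupoid.Equation, hz, hfz, zero_mul, sub_self]
  | order2 μ hμ =>
    refine h₁.eq_of_cocycle h₂ hβ₁ hβ₂ (hμ 0 hmem) one_pos (q := fun j => j + 1) ?_
      h₁.tendsto_iteratedDeriv_two_div_deriv h₂.tendsto_iteratedDeriv_two_div_deriv
      (he₁.mono fun z hz => ?_) (he₂.mono fun z hz => ?_)
    · exact fun a b hab => by simpa using hab
    all_goals rw [zpow_one]; exact sub_eq_zero.1 hz
  | order3 ν hν =>
    refine h₁.eq_of_cocycle h₂ hβ₁ hβ₂ (hν 0 hmem) two_pos (q := fun j => j ^ 2 - 1) ?_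
      h₁.tendsto_schwarzian h₂.tendsto_schwarzian
      (he₁.mono fun z hz => ?_) (he₂.mono fun z hz => ?_)
    · intro a b hab
      exact Nat.pow_left_injective two_ne_zero (by exact_mod_cast sub_left_injective hab)
    all_goals rw [zpow_ofNat, ← add_sub_assoc]; exact sub_eq_zero.1 hz
  | infinite => exact absurd (fun p hp => ⟨hp, Eventually.of_forall fun _ => rfl⟩) hD

end DGroupoid

section ContactTaylor

open PowerSeries

variable {𝕜 : Type*} [NontriviallyNormedField 𝕜] [CompleteSpace 𝕜] [CharZero 𝕜] {j : ℕ} {β : 𝕜}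
  {f u : 𝕜 → 𝕜}

theorem taylorSeries_sub_X_eq_X_pow_mul {n : ℕ} (hf : AnalyticAt 𝕜 f 0)
    (hu : AnalyticAt 𝕜 u 0) (e : (fun z => f z - z) =ᶠ[𝓝 0] fun z => z ^ n * u z) :
    taylorSeries f - X = X ^ n * taylorSeries u := by
  have hid : AnalyticAt 𝕜 (fun z : 𝕜 => z) 0 := analyticAt_id
  rw [← taylorSeries_pow_mul hu, ← taylorSeries_congr e, sub_eq_iff_eq_add, ← taylorSeries_id,
    ← taylorSeries_add (hf.fun_sub hid) hid]
  simp only [sub_add_cancel]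

theorem HasContact.X_pow_dvd_taylorSeries_sub_X (h : HasContact j β f) :
    X ^ (j + 1) ∣ taylorSeries f - X := by
  obtain ⟨u, hu, -, e⟩ := h.exists_analyticAt
  exact ⟨_, taylorSeries_sub_X_eq_X_pow_mul h.analyticAt hu e⟩

theorem HasContact.coeff_taylorSeries (h : HasContact j β f) :
    coeff (j + 1) (taylorSeries f) = β := by
  obtain ⟨u, hu, rfl, e⟩ := h.exists_analyticAt
  rw [← coeff_succ_sub_X h.one_le, taylorSeries_sub_X_eq_X_pow_mul h.analyticAt hu e,
    coeff_X_pow_mul', if_pos le_rfl, Nat.sub_self, coeff_zero_taylorSeries]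

end ContactTaylor

section Germs

open PowerSeries

theorem Diff.analyticAt_rep (g : Diff) : AnalyticAt ℂ g.rep 0 := MapGerm.rep_analyticAt _

theorem Diff.rep_zero (g : Diff) : g.rep 0 = 0 := MapGerm.rep_zero _

theorem Diff.rep_mul (g h : Diff) : (g * h).rep =ᶠ[𝓝 0] fun z => g.rep (h.rep z) :=
  MapGerm.rep_mul (g : MapGerm) (h : MapGerm)

theorem Diff.rep_one : Diff.rep 1 =ᶠ[𝓝 0] fun z => z := MapGerm.rep_one

theorem Diff.ext_rep {g h : Diff} (e : g.rep =ᶠ[𝓝 0] h.rep) : g = h :=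
  Units.ext (MapGerm.ext_rep e)

/-- The homomorphism `g ↦ g'(0)`. -/
def multiplier : Diff →* ℂˣ :=
  MonoidHom.toHomUnits
    { toFun := fun g => deriv g.rep 0
      map_one' := Diff.deriv_rep_one
      map_mul' := Diff.deriv_rep_mul }

theorem ker_multiplier : multiplier.ker = tangentToId := by
  ext g
  rw [MonoidHom.mem_ker, Units.ext_iff]
  rfl

theorem Diff.deriv_rep_ne_zero (g : Diff) : deriv g.rep 0 ≠ 0 := (multiplier g).ne_zero

theorem Diff.taylor_eq_taylorSeries (g : Diff) : g.taylor = taylorSeries g.rep := rfl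

theorem Diff.taylor_one : Diff.taylor 1 = X :=
  (taylorSeries_congr Diff.rep_one).trans taylorSeries_id

/-- The substitution `φ ↦ φ ∘ g` of the Taylor series of `g` into formal series. -/
def Diff.substHom (g : Diff) : ℂ⟦X⟧ →ₐ[ℂ] ℂ⟦X⟧ :=
  substAlgHom (R := ℂ) (hasSubst_taylorSeries g.rep_zero)

theorem Diff.substHom_X (g : Diff) : g.substHom X = g.taylor := substAlgHom_X _

theorem Diff.X_dvd_substHom_X (g : Diff) : X ∣ g.substHom X := by
  rw [g.substHom_X, X_dvd_iff, ← coeff_zero_eq_constantCoeff_apply, g.taylor_eq_taylorSeries,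
    coeff_zero_taylorSeries, g.rep_zero]

theorem Diff.substHom_taylor (g h : Diff) : h.substHom g.taylor = (g * h).taylor := by
  rw [Diff.taylor_eq_taylorSeries (g * h), taylorSeries_congr (Diff.rep_mul g h),
    taylorSeries_comp g.analyticAt_rep h.analyticAt_rep h.rep_zero]
  rfl

theorem Diff.substHom_mul (g h : Diff) : (g * h).substHom = h.substHom * g.substHom := by
  refine (algHom_ext_X (g * h).X_dvd_substHom_X ?_).symm
  rw [AlgHom.mul_apply, g.substHom_X, Diff.substHom_taylor, Diff.substHom_X]

theorem X_sq_dvd_taylor_sub_X {g : Diff} (hg : g ∈ tangentToId) : X ^ 2 ∣ g.taylor - X := by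
  rw [X_pow_dvd_iff, g.taylor_eq_taylorSeries]
  intro k hk
  interval_cases k
  · rw [map_sub, coeff_zero_taylorSeries, g.rep_zero, coeff_zero_X, sub_zero]
  · rw [map_sub, coeff_one_taylorSeries, show deriv g.rep 0 = 1 from hg, coeff_one_X, sub_self]

theorem exists_hasContact {g : Diff} (hg : g ∈ tangentToId) (h1 : g ≠ 1) :
    ∃ j β, HasContact j β g.rep ∧ β ≠ 0 := by
  have hd : AnalyticAt ℂ (fun z => g.rep z - z) 0 := g.analyticAt_rep.fun_sub analyticAt_id
  have hne : ¬ ∀ᶠ z in 𝓝 (0 : ℂ), g.rep z - z = 0 := fun h =>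
    h1 (Diff.ext_rep (EventuallyEq.trans (h.mono fun z hz => sub_eq_zero.1 hz) Diff.rep_one.symm))
  obtain ⟨n, u, hu, hu0, e⟩ := hd.exists_eventuallyEq_pow_smul_nonzero_iff.2 hne
  simp only [sub_zero, smul_eq_mul] at e
  have hn : 2 ≤ n := by
    by_contra! hlt
    have hcoeff := X_pow_dvd_iff.1 (X_sq_dvd_taylor_sub_X hg) n hlt
    rw [g.taylor_eq_taylorSeries, taylorSeries_sub_X_eq_X_pow_mul g.analyticAt_rep hu e,
      coeff_X_pow_mul', if_pos le_rfl, Nat.sub_self, coeff_zero_taylorSeries] at hcoeff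
    exact hu0 hcoeff
  obtain ⟨j, rfl⟩ : ∃ j, n = j + 1 := ⟨n - 1, by lia⟩
  exact ⟨j, u 0, ⟨by lia, u, hu, rfl, e⟩, hu0⟩

end Germs

section ContactOrder

open PowerSeries

/-- The elements of `G` tangent to the identity, other than the identity itself, are all of the form
`z + β z ^ (j + 1) + ⋯` with `β ≠ 0`, for one and the same `j ≥ 1`. -/
structure HasContactOrder (j : ℕ) (G : Subgroup Diff) : Prop where
  one_le : 1 ≤ j
  X_pow_dvd : ∀ g ∈ G ⊓ tangentToId, X ^ (j + 1) ∣ g.taylor - X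
  eq_one : ∀ g ∈ G ⊓ tangentToId, coeff (j + 1) g.taylor = 0 → g = 1

variable {j : ℕ} {G : Subgroup Diff}

theorem HasContactOrder.coeff_taylor_mul (hG : HasContactOrder j G) {g h : Diff}
    (hg : g ∈ G ⊓ tangentToId) (hh : h ∈ G ⊓ tangentToId) :
    coeff (j + 1) (g * h).taylor = coeff (j + 1) h.taylor + coeff (j + 1) g.taylor := by
  have hdvd := hG.X_pow_dvd h hh
  rw [← h.substHom_X] at hdvd
  rw [← Diff.substHom_taylor, coeff_algHom_of_X_sq_dvd_sub hG.one_le hdvd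
    (X_sq_dvd_taylor_sub_X hg.2), h.substHom_X]

theorem HasContactOrder.commute (hG : HasContactOrder j G) {g h : Diff}
    (hg : g ∈ G ⊓ tangentToId) (hh : h ∈ G ⊓ tangentToId) : g * h = h * g := by
  have hw : g * h * (h * g)⁻¹ ∈ G ⊓ tangentToId :=
    mul_mem (mul_mem hg hh) (inv_mem (mul_mem hh hg))
  have hcoeff := hG.coeff_taylor_mul hw (mul_mem hh hg)
  rw [inv_mul_cancel_right, hG.coeff_taylor_mul hg hh, hG.coeff_taylor_mul hh hg, add_comm,
    left_eq_add] at hcoeff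
  exact mul_inv_eq_one.1 (hG.eq_one _ hw hcoeff)

theorem HasContactOrder.isSolvable (hG : HasContactOrder j G) : Group.IsSolvable G := by
  have hker : Group.IsSolvable (multiplier.comp G.subtype).ker := by
    refine Group.isSolvable_of_comm fun a b => ?_
    have hmem : ∀ c : (multiplier.comp G.subtype).ker, ((c : G) : Diff) ∈ G ⊓ tangentToId :=
      fun c => ⟨(c : G).2, by rw [← ker_multiplier]; exact c.2⟩
    exact Subtype.ext (Subtype.ext (hG.commute (hmem a) (hmem b)))
  exact Group.isSolvable_of_ker_le_range (multiplier.comp G.subtype).ker.subtype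
    (multiplier.comp G.subtype) (by rw [Subgroup.range_subtype])

theorem HasContactOrder.exists_isExp (hG : HasContactOrder j G) :
    ∃ a : ℂ⟦X⟧, X ^ 2 ∣ a ∧ ∀ g ∈ G ⊓ tangentToId, ∃ c : ℂ, IsExp c a g.taylor := by
  suffices H : ∃ (ρ : ℂ⟦X⟧ →ₐ[ℂ] ℂ⟦X⟧) (hρ : X ^ 2 ∣ ρ X - X),
      ∀ g ∈ G ⊓ tangentToId, ∃ c, flow hρ c = g.substHom by
    obtain ⟨ρ, hρ, hflow⟩ := H
    refine ⟨generator hρ X, X_sq_dvd_generator_X hρ, fun g hg => ?_⟩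
    obtain ⟨c, hc⟩ := hflow g hg
    exact ⟨c, g.substHom_X ▸ hc ▸ isExp_flow hρ c⟩
  by_cases htriv : ∀ g ∈ G ⊓ tangentToId, g = 1
  · refine ⟨Diff.substHom 1, by simp [Diff.substHom_X, Diff.taylor_one], fun g hg => ⟨1, ?_⟩⟩
    rw [htriv g hg, flow_one]
  push Not at htriv
  obtain ⟨g, hg, hg1⟩ := htriv
  have hdvd : ∀ h ∈ G ⊓ tangentToId, X ^ (j + 1) ∣ h.substHom X - X := fun h hh => by
    rw [h.substHom_X]; exact hG.X_pow_dvd h hh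
  have hg2 : X ^ 2 ∣ g.substHom X - X := by rw [g.substHom_X]; exact X_sq_dvd_taylor_sub_X hg.2
  have hg0 : coeff (j + 1) (g.substHom X) ≠ 0 := by
    rw [g.substHom_X]; exact mt (hG.eq_one g hg) hg1
  refine ⟨g.substHom, hg2, fun h hh => ?_⟩
  refine exists_flow_eq_of_commute hg2 hG.one_le (hdvd g hg) hg0 (hdvd h hh) ?_
  rw [Commute, SemiconjBy, ← Diff.substHom_mul, ← Diff.substHom_mul, hG.commute hh hg]

theorem exists_hasContactOrder {r : ℝ} {D : DGroupoid r} (hD : ¬ autDisc r ⊆ D.sol)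
    (hG : D.Admits G) : ∃ j, HasContactOrder j G := by
  by_cases htriv : ∀ g ∈ G ⊓ tangentToId, g = 1
  · refine ⟨1, le_rfl, fun g hg => ?_, fun g hg _ => htriv g hg⟩
    rw [htriv g hg, Diff.taylor_one, sub_self]
    exact dvd_zero _
  push Not at htriv
  obtain ⟨g, hg, hg1⟩ := htriv
  obtain ⟨j, β, hβ, hβ0⟩ := exists_hasContact hg.2 hg1
  have hcontact : ∀ h ∈ G ⊓ tangentToId, h ≠ 1 → ∃ γ, HasContact j γ h.rep ∧ γ ≠ 0 := by
    intro h hh hh1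
    obtain ⟨i, γ, hγ, hγ0⟩ := exists_hasContact hh.2 hh1
    obtain rfl := DGroupoid.contact_order_unique hD hβ hγ hβ0 hγ0 (hG g hg.1) (hG h hh.1)
    exact ⟨γ, hγ, hγ0⟩
  refine ⟨j, hβ.one_le, fun h hh => ?_, fun h hh => ?_⟩
  · obtain rfl | hh1 := eq_or_ne h 1
    · rw [Diff.taylor_one, sub_self]
      exact dvd_zero _
    · obtain ⟨γ, hγ, -⟩ := hcontact h hh hh1
      exact hγ.X_pow_dvd_taylorSeries_sub_X
  · contrapose
    intro hh1
    obtain ⟨γ, hγ, hγ0⟩ := hcontact h hh hh1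
    rwa [h.taylor_eq_taylorSeries, hγ.coeff_taylorSeries]

theorem HasProperGaloisClosure.exists_admits {r : ℝ} (hr : 0 < r)
    (hG : HasProperGaloisClosure r G) :
    ∃ D : DGroupoid r, D.Admits G ∧ ¬ autDisc r ⊆ D.sol := by
  by_contra! hall
  have hinfinite : (DGroupoid.infinite : DGroupoid r).Admits G := fun g _ =>
    ⟨⟨Metric.mem_ball_self hr, g.analyticAt_rep, by simpa [g.rep_zero] using hr,
      g.deriv_rep_ne_zero⟩, Eventually.of_forall fun _ => rfl⟩
  exact hG (Set.Subset.antisymm (fun p hp => (hp .infinite hinfinite).1)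
    fun p hp D hD => hall D hD hp)

end ContactOrder

end GaloisClosure

end

theorem proposition1p7 (r : ℝ) (hr : 0 < r) (G : Subgroup GaloisClosure.Diff)
    (hG : GaloisClosure.HasProperGaloisClosure r G) :
    Group.IsSolvable G ∧
    (∀ g ∈ G ⊓ GaloisClosure.tangentToId, ∀ h ∈ G ⊓ GaloisClosure.tangentToId,
      g * h = h * g) ∧
    ∃ a : PowerSeries ℂ, PowerSeries.X ^ 2 ∣ a ∧
      ∀ g ∈ G ⊓ GaloisClosure.tangentToId, ∃ c : ℂ, GaloisClosure.IsExp c a g.taylor := by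
  obtain ⟨D, hDG, hD⟩ := hG.exists_admits hr
  obtain ⟨j, hj⟩ := GaloisClosure.exists_hasContactOrder hD hDG
  exact ⟨hj.isSolvable, fun g hg h hh => hj.commute hg hh, hj.exists_isExp⟩
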